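/- Let $F$ be a field, $V$ a finite-dimensional $F$-vector space, $\mathcal{K}$ a commutative ring, and $\mathcal{A}$ an affine hyperplane arrangement in $V$, i.e. a finite set of affine hyperplanes of $V$. Let $L(\mathcal{A})$ be the set of all nonempty intersections of hyperplanes of $\mathcal{A}$ (including the empty intersection $\hat 0=V$), ordered by reverse inclusion, with rank function $r(X)=\operatorname{codim} X$. An ideal of $L(\mathcal{A})$ is a nonempty down-closed subset; write $\langle X\rangle=\{Y\in L(\mathcal{A}) : Y\le X\}$. Ideals $\mathcal{I}_1,\dots,\mathcal{I}_m$ form an ideal decomposition of $L(\mathcal{A})$ if (I1) for every $X\in L(\mathcal{A})\setminus\{\hat 0\}$ there is a $j$ such that $\mathcal{I}_j\cap\langle X\rangle=\langle Z\rangle$ for some $Z\ne\hat 0$; (I2) for all $X_i\in\mathcal{I}_i$ ($1\le i\le m$) the intersection $X_1\cap\dots\cap X_m$ is nonempty; and (I3) in (I2), $r(X_1\cap\dots\cap X_m)=\sum_{i} r(X_i)$. An ideal $\mathcal{I}$ is modular if $\{\mathcal{I},\mathcal{I}^c\}$ is an ideal decomposition, where $\mathcal{I}^c=\{Y\in L(\mathcal{A})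 : Y\wedge X=\hat 0 \text{ for all } X\in\mathcal{I}\}$. Let $E(\mathcal{A})$ be the exterior algebra over $\mathcal{K}$ of the free $\mathcal{K}$-module with basis $\{e_H : H\in\mathcal{A}\}$, and let $\partial$ be the $\mathcal{K}$-linear map on $E(\mathcal{A})$ with $\partial(e_{H_1}\cdots e_{H_p})=\sum_{k=1}^p(-1)^{k-1}e_{H_1}\cdots\widehat{e_{H_k}}\cdots e_{H_p}$ (so $\partial 1=0$ and $\partial e_H=1$). For a tuple $S=(H_1,\dots,H_p)$ of hyperplanes of $\mathcal{A}$ put $e_S=e_{H_1}\cdots e_{H_p}$ and $\cap S=H_1\cap\dots\cap H_p$; $S$ is dependent if $\cap S\ne\emptyset$ and $r(\cap S)<p$. The Orlik–Solomon algebra is $A(\mathcal{A})=E(\mathcal{A})/I(\mathcal{A})$, where $I(\mathcal{A})$ is the two-sided ideal generated by all $e_S$ with $\cap S=\emptyset$ and all $\partial e_S$ with $S$ dependent; its degree $p$ part is the image of the $p$-th exterior power. For $X\in L(\mathcal{A})$ let $A_X(\mathcal{A})\subseteq A(\mathcal{A})$ be the $\mathcal{K}$-submodule spanned by the images of all $e_S$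 with $\cap S=X$. Then for every modular ideal $\mathcal{I}$ of $L(\mathcal{A})$, the $\mathcal{K}$-linear map $$\kappa\colon \Big(\bigoplus_{X\in\mathcal{I}}A_X(\mathcal{A})\Big)\otimes_{\mathcal{K}}\Big(\bigoplus_{Y\in\mathcal{I}^c}A_Y(\mathcal{A})\Big)\longrightarrow A(\mathcal{A})$$ defined by multiplication in $A(\mathcal{A})$ is an isomorphism of graded $\mathcal{K}$-modules, where the direct sums carry the grading induced from $A(\mathcal{A})$ and the tensor product the total grading: both sides are the direct sums of their degree $p$ parts ($p\ge 0$), $\kappa$ is bijective, and $\kappa$ maps the degree $p$ part onto the degree $p$ part for every $p$. -/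

import Mathlib

open scoped DirectSum TensorProduct

/-- The codimension of (the direction of) an affine subspace. -/
noncomputable def affineCodim {F V : Type*} [Field F] [AddCommGroup V] [Module F V]
    (X : AffineSubspace F V) : ℕ :=
  Module.finrank F (V ⧸ X.direction)

/-- A finite collection of affine hyperplanes in `V`. -/
structure HyperplaneArrangement (F V : Type*) [Field F] [AddCommGroup V] [Module F V] where
  hyperplanes : Finset (AffineSubspace F V)
  nonempty_of_mem : ∀ H ∈ hyperplanes, (H : Set V).Nonempty
  codim_eq_one : ∀ H ∈ hyperplanes, affineCodim H = 1

namespace HyperplaneArrangement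

section Poset

variable {F V : Type*} [Field F] [AddCommGroup V] [Module F V]

/-- The set of nonempty intersections of hyperplanes of `𝒜`
(the empty intersection being `V`). -/
def IntersectionPoset (𝒜 : HyperplaneArrangement F V) : Type _ :=
  {X : AffineSubspace F V // (X : Set V).Nonempty ∧ ∃ B ⊆ 𝒜.hyperplanes, B.inf id = X}

variable {𝒜 : HyperplaneArrangement F V}

/-- The order is reverse inclusion. -/
instance : PartialOrder 𝒜.IntersectionPoset where
  le X Y := Y.1 ≤ X.1
  le_refl X := le_refl X.1
  le_trans _ _ _ h h' := le_trans h' h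
  le_antisymm _ _ h h' := Subtype.ext (le_antisymm h' h)

/-- The minimal element is the whole space `V`. -/
instance : OrderBot 𝒜.IntersectionPoset where
  bot := ⟨⊤, ⟨0, trivial⟩, ∅, Finset.empty_subset _, Finset.inf_empty⟩
  bot_le X := (le_top : X.1 ≤ ⊤)

/-- The rank of an element of the intersection poset is its codimension. -/
noncomputable def rank (X : 𝒜.IntersectionPoset) : ℕ := affineCodim X.1

/-- Order ideals: nonempty down-closed subsets. -/
def IsOrderIdeal (I : Set 𝒜.IntersectionPoset) : Prop := I.Nonempty ∧ IsLowerSet I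

/-- `J` is a principal ideal `⟨Z⟩` with `Z` not the minimal element. -/
def IsNontrivialPrincipal (J : Set 𝒜.IntersectionPoset) : Prop :=
  ∃ Z : 𝒜.IntersectionPoset, Z ≠ ⊥ ∧ J = Set.Iic Z

/-- Ideal decompositions of the intersection poset. The join of a family of elements is
its intersection, and exists if and only if this intersection is nonempty. -/
structure IsIdealDecomposition {m : ℕ} (I : Fin m → Set 𝒜.IntersectionPoset) : Prop where
  ideal : ∀ j, IsOrderIdeal (I j)
  meet : ∀ X : 𝒜.IntersectionPoset, X ≠ ⊥ → ∃ j, IsNontrivialPrincipal (I j ∩ Set.Iic X)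
  join : ∀ X : Fin m → 𝒜.IntersectionPoset, (∀ j, X j ∈ I j) →
    ((⨅ j, (X j).1 : AffineSubspace F V) : Set V).Nonempty
  rank_join : ∀ X : Fin m → 𝒜.IntersectionPoset, (∀ j, X j ∈ I j) →
    affineCodim (⨅ j, (X j).1) = ∑ j, rank (X j)

/-- The meet-complement: all `Y` whose meet with every `X ∈ I` is the minimal element. -/
def meetComplement (I : Set 𝒜.IntersectionPoset) : Set 𝒜.IntersectionPoset :=
  {Y | ∀ X ∈ I, IsGLB {Y, X} ⊥}

/-- `I` is a modular ideal if `{I, Iᶜ}` is an ideal decomposition. -/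
def IsModularIdeal (I : Set 𝒜.IntersectionPoset) : Prop :=
  IsIdealDecomposition ![I, meetComplement I]

end Poset

section OrlikSolomon

variable {F V : Type*} [Field F] [AddCommGroup V] [Module F V]
variable (𝒜 : HyperplaneArrangement F V) (K : Type*) [CommRing K]

/-- The exterior algebra of the free module on the hyperplanes. -/
abbrev Ext : Type _ := ExteriorAlgebra K (𝒜.hyperplanes →₀ K)

variable {𝒜}

/-- `e_S = e_{H_1} ⋯ e_{H_p}` for a tuple `S = (H_1, …, H_p)` of hyperplanes. -/
noncomputable def e (S : List 𝒜.hyperplanes) : 𝒜.Ext K :=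
  (S.map fun H => ExteriorAlgebra.ι K (Finsupp.single H (1 : K))).prod

/-- `∩ S` for a tuple `S` of hyperplanes. -/
def inter (S : List 𝒜.hyperplanes) : AffineSubspace F V :=
  (S.map Subtype.val).foldr (· ⊓ ·) ⊤

/-- A tuple is dependent if it has nonempty intersection of codimension less than its length. -/
def Dependent (S : List 𝒜.hyperplanes) : Prop :=
  (inter S : Set V).Nonempty ∧ affineCodim (inter S) < S.length

variable (𝒜)

/-- The boundary map of the exterior algebra: contraction with the linear form
taking the value `1` on every `e_H`. See `boundary_e` for the explicit formula. -/
noncomputable def boundary : 𝒜.Ext K →ₗ[K] 𝒜.Ext K :=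
  CliffordAlgebra.contractLeft (Finsupp.linearCombination K fun _ : 𝒜.hyperplanes => (1 : K))

/-- `∂(e_{H_1} ⋯ e_{H_p}) = ∑ₖ (-1)^(k-1) e_{H_1} ⋯ ê_{H_k} ⋯ e_{H_p}`. -/
theorem boundary_e (S : List 𝒜.hyperplanes) :
    boundary 𝒜 K (e K S) =
      ∑ k ∈ Finset.range S.length, (-1 : K) ^ k • e K (S.eraseIdx k) := by
  induction S with
  | nil => simp [boundary, e]
  | cons H S ih =>
    have h : e K (H :: S) = ExteriorAlgebra.ι K (Finsupp.single H (1 : K)) * e K S := by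
      simp [e]
    have h2 : boundary 𝒜 K (ExteriorAlgebra.ι K (Finsupp.single H (1 : K)) * e K S) =
        e K S - ExteriorAlgebra.ι K (Finsupp.single H (1 : K)) * boundary 𝒜 K (e K S) := by
      unfold boundary
      erw [CliffordAlgebra.contractLeft_ι_mul]
      simp
    rw [h, h2, ih, List.length_cons, Finset.sum_range_succ', Finset.mul_sum, sub_eq_add_neg,
      add_comm, ← Finset.sum_neg_distrib]
    congr 1
    · refine Finset.sum_congr rfl fun k _ => ?_
      simp [e, pow_succ]
    · simp

/-- The two-sided ideal generated by `e_S` for `∩ S = ∅` and by `∂ e_S` for `S` dependent. -/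
noncomputable def osIdeal : TwoSidedIdeal (𝒜.Ext K) :=
  TwoSidedIdeal.span
    ({x | ∃ S : List 𝒜.hyperplanes, ¬ (inter S : Set V).Nonempty ∧ x = e K S} ∪
     {x | ∃ S : List 𝒜.hyperplanes, Dependent S ∧ x = boundary 𝒜 K (e K S)})

/-- The Orlik–Solomon algebra. -/
abbrev OSAlgebra : Type _ := 𝒜.Ext K ⧸ (osIdeal 𝒜 K).asIdeal

/-- The natural projection onto the Orlik–Solomon algebra. -/
noncomputable def osProj : 𝒜.Ext K →ₐ[K] 𝒜.OSAlgebra K :=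
  Ideal.Quotient.mkₐ K (osIdeal 𝒜 K).asIdeal

/-- The graded component of degree `p` of the Orlik–Solomon algebra: the image of the
`p`-th exterior power. -/
noncomputable def osDegree (p : ℕ) : Submodule K (𝒜.OSAlgebra K) :=
  (⋀[K]^p (𝒜.hyperplanes →₀ K)).map (osProj 𝒜 K).toLinearMap

variable {𝒜}

/-- `E_X`, the span of the `e_S` with `∩ S = X`. -/
noncomputable def extComponent (X : 𝒜.IntersectionPoset) : Submodule K (𝒜.Ext K) :=
  Submodule.span K {x | ∃ S : List 𝒜.hyperplanes, inter S = X.1 ∧ x = e K S}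

/-- `A_X`, the image of `E_X` in the Orlik–Solomon algebra. -/
noncomputable def osComponent (X : 𝒜.IntersectionPoset) : Submodule K (𝒜.OSAlgebra K) :=
  (extComponent K X).map (osProj 𝒜 K).toLinearMap

/-- The (external) direct sum of the modules `A_X` over `X ∈ I`. -/
abbrev OSSum (I : Set 𝒜.IntersectionPoset) : Type _ := ⨁ X : I, osComponent K X.1

/-- The sum of the inclusions `A_X → A(𝒜)`. -/
noncomputable def osSumMap (I : Set 𝒜.IntersectionPoset) : OSSum K I →ₗ[K] 𝒜.OSAlgebra K := by
  classical exact DirectSum.coeLinearMap fun X : I => osComponent K X.1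

/-- The degree `p` part of `⨁ A_X`: all coordinates have degree `p` in `A(𝒜)`. -/
noncomputable def osSumDegree (I : Set 𝒜.IntersectionPoset) (p : ℕ) : Submodule K (OSSum K I) :=
  ⨅ X : I, (osDegree 𝒜 K p).comap
    ((osComponent K X.1).subtype ∘ₗ DirectSum.component K I (fun X => osComponent K X.1) X)

/-- The total degree `p` part of `(⨁_{X ∈ I} A_X) ⊗ (⨁_{Y ∈ J} A_Y)`. -/
noncomputable def osTensorDegree (I J : Set 𝒜.IntersectionPoset) (p : ℕ) :
    Submodule K (OSSum K I ⊗[K] OSSum K J) :=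
  ⨆ (i : ℕ) (j : ℕ) (_ : i + j = p),
    LinearMap.range (TensorProduct.map
      (osSumDegree K I i).subtype (osSumDegree K J j).subtype)

/-- The linear map `(⨁_{X ∈ I} A_X) ⊗ (⨁_{Y ∈ J} A_Y) → A(𝒜)` given by multiplication. -/
noncomputable def kappa (I J : Set 𝒜.IntersectionPoset) :
    OSSum K I ⊗[K] OSSum K J →ₗ[K] 𝒜.OSAlgebra K :=
  TensorProduct.lift
    ((LinearMap.mul K (𝒜.OSAlgebra K)).compl₁₂ (osSumMap K I) (osSumMap K J))

end OrlikSolomon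

end HyperplaneArrangement

/-! Let `ρ_X` be the localization of `A(𝒜)` at a flat `X`, killing `e_H` for `X ⊄ H`. It is the
identity on `A_Y` if `Y ≤ X` and zero otherwise, so applying `ρ_X` for larger and larger `X` to a
relation shows Brieskorn's decomposition `A(𝒜) = ⨁ A_X`. All hyperplanes through `X` have a common
point, so `∂_X = ∂ ∘ ρ_X` is well defined on `A(𝒜)`. It is a skew derivation relative to `ρ_X`;
applying it to `e_H a = 0` gives `e_H ∂_X a = a` for `a ∈ A_Y` with `Y ≤ X` and `Y ⊆ H`.

Let `T_X ⊆ A(𝒜) ⊗ A(𝒜)` be the sum of all `A_Y ⊗ A_Z` with `Y ∈ I`, `Z ∈ J` and `Y ∩ Z = X`.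
Multiplication sends `T_X` to `A_X`, and induction on `X` shows that it does so bijectively. The
base `X = ⊥` is clear. For `X ≠ ⊥`, (I1) gives a flat `W ≠ ⊥` with, say, `I ∩ ⟨X⟩ = ⟨W⟩`; choose a
hyperplane `H ⊇ W`. By (I3), `Y = W` for every summand `A_Y ⊗ A_Z` of `T_X`.

* Injectivity: the operator `D_X = ∂_X ⊗ 1 + σ ⊗ ∂_X`, with `σ` the grade involution, maps `T_X`
  into the sum of the `T_Y` with `Y < X` and corresponds to `∂_X` under multiplication. If `t ∈ T_X`
  has product zero, then so does `D_X t`, hence `D_X t = 0` by induction and Brieskorn's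
  decomposition. Multiplying the first factor by `e_H` gives back `t`.
* Surjectivity: every `a = e_H ∂_X a` in `A_X` is a sum of products `e_H b` with `b ∈ A_Y`, `Y < X`
  and `X = H ∩ Y`. By induction `b` comes from `T_Y`, and `e_H` can be absorbed into the first
  factor because `I ∩ ⟨X⟩ = ⟨W⟩` is closed under intersecting with `H`.
-/

section CliffordAlgebra

open CliffordAlgebra

variable {R M : Type*} [CommRing R] [AddCommGroup M] [Module R M] {Q : QuadraticForm R M}

theorem contractLeft_mul (d : Module.Dual R M) (x y : CliffordAlgebra Q) :
    contractLeft d (x * y) = contractLeft d x * y + involute x * contractLeft d y := by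
  induction x using left_induction with
  | algebraMap r => simp only [contractLeft_algebraMap_mul, contractLeft_algebraMap,
      AlgHom.commutes, zero_mul, zero_add]
  | add a b ha hb => simp only [add_mul, map_add, ha, hb]; abel
  | ι_mul a m ha =>
    simp only [mul_assoc, contractLeft_ι_mul, ha, map_mul, involute_ι, sub_mul, mul_add,
      smul_mul_assoc, neg_mul]
    abel

theorem contractLeft_involute (d : Module.Dual R M) (x : CliffordAlgebra Q) :
    contractLeft d (involute x) = -involute (contractLeft d x) := by
  induction x using left_induction with
  | algebraMap r => simp only [AlgHom.commutes, contractLeft_algebraMap, map_zero, neg_zero]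
  | add a b ha hb => simp only [map_add, ha, hb, neg_add]
  | ι_mul a m ha =>
    simp only [map_mul, involute_ι, contractLeft_ι_mul, map_neg, neg_mul, ha, map_sub, map_smul,
      mul_neg]

end CliffordAlgebra

section LinearAlgebra

variable {R M N : Type*} [CommRing R] [AddCommGroup M] [Module R M] [AddCommGroup N] [Module R N]
  {ι κ : Type*}

theorem iSupIndep_iSup_fiber {T : ι → Submodule R M} (hT : iSupIndep T) (r : ι → κ) :
    iSupIndep fun k => ⨆ (i) (_ : r i = k), T i := by
  intro k
  refine (hT.disjoint_biSup_biSup (s := {i | r i = k}) (t := {i | r i ≠ k})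
    (Set.disjoint_left.2 fun i hi hi' => hi' hi)).mono_right ?_
  exact iSup₂_le fun l hl => iSup₂_le fun i hi =>
    le_iSup₂_of_le i (show r i ≠ k from hi.trans_ne hl) le_rfl

theorem disjoint_iSup_ker_of_iSupIndep_map {T : ι → Submodule R M} (f : M →ₗ[R] N)
    (hind : iSupIndep fun i => (T i).map f)
    (hker : ∀ i, Disjoint (T i) (LinearMap.ker f)) : Disjoint (⨆ i, T i) (LinearMap.ker f) := by
  refine LinearMap.disjoint_ker.2 fun x hx hfx => ?_
  obtain ⟨t, ht, rfl⟩ := (Submodule.mem_iSup_iff_exists_finsupp T x).1 hx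
  refine Finset.sum_eq_zero fun i hi => LinearMap.disjoint_ker.1 (hker i) _ (ht i) ?_
  refine (iSupIndep_iff_finsetSum_eq_zero_imp_eq_zero _).1 hind t.support (fun j => f (t j))
    (fun j _ => Submodule.mem_map_of_mem (ht j)) ?_ i hi
  rwa [Finsupp.sum, map_sum] at hfx

theorem exists_leftInverse_coeLinearMap [DecidableEq ι] {T : ι → Submodule R M}
    (hT : DirectSum.IsInternal T) (s : Set ι) :
    ∃ g : M →ₗ[R] ⨁ i : s, T i, g ∘ₗ DirectSum.coeLinearMap (fun i : s => T i) = .id := by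
  classical
  refine ⟨DirectSum.toModule R ι _ (fun i =>
    if hi : i ∈ s then DirectSum.lof R s (fun j : s => T j) ⟨i, hi⟩ else 0) ∘ₗ
    (LinearEquiv.ofBijective (DirectSum.coeLinearMap T) hT).symm.toLinearMap, ?_⟩
  refine DirectSum.linearMap_ext R fun i => LinearMap.ext fun x => ?_
  have hx : (LinearEquiv.ofBijective (DirectSum.coeLinearMap T) hT).symm x =
      DirectSum.lof R ι (fun i => T i) i x := by
    rw [LinearEquiv.symm_apply_eq]
    exact (DirectSum.coeLinearMap_lof T i x).symm
  simp [hx]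

end LinearAlgebra

section CommSemiring

variable {R M N P Q : Type*} [CommSemiring R] [AddCommMonoid M] [Module R M] [AddCommMonoid N]
  [Module R N] [AddCommMonoid P] [Module R P] [AddCommMonoid Q] [Module R Q] {ι : Type*}

theorem isInternal_of_isInternal_map [DecidableEq ι] {T : ι → Submodule R M} {f : M →ₗ[R] N}
    (hf : Function.Bijective f) (h : DirectSum.IsInternal fun i => (T i).map f) :
    DirectSum.IsInternal T := by
  let g : (⨁ i, T i) →ₗ[R] ⨁ i, (T i).map f := DirectSum.lmap fun i => f.submoduleMap (T i)
  have hg : Function.Bijective g :=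
    ⟨(DirectSum.lmap_injective _).2 fun i => LinearMap.submoduleMap_injective hf.1 (T i),
      (DirectSum.lmap_surjective _).2 fun i => f.submoduleMap_surjective (T i)⟩
  have hcomp : f ∘ₗ DirectSum.coeLinearMap T =
      DirectSum.coeLinearMap (fun i => (T i).map f) ∘ₗ g := by
    ext i x
    simp [g]
  have hbij : Function.Bijective (f ∘ₗ DirectSum.coeLinearMap T) := hcomp ▸ h.comp hg
  exact (Function.Bijective.of_comp_iff' hf _).1 hbij

theorem tensorMap_injective_of_leftInverse {f : M →ₗ[R] N} {g : P →ₗ[R] Q}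
    (hf : ∃ f' : N →ₗ[R] M, f' ∘ₗ f = .id) (hg : ∃ g' : Q →ₗ[R] P, g' ∘ₗ g = .id) :
    Function.Injective (TensorProduct.map f g) := by
  obtain ⟨f', hf⟩ := hf
  obtain ⟨g', hg⟩ := hg
  refine Function.LeftInverse.injective (g := TensorProduct.map f' g') fun x => ?_
  rw [← LinearMap.comp_apply, ← TensorProduct.map_comp, hf, hg, TensorProduct.map_id,
    LinearMap.id_apply]

theorem tmul_mem_of_mem_iSup_left {T : ι → Submodule R M} {p : Submodule R (M ⊗[R] N)} {x : M}
    (hx : x ∈ ⨆ i, T i) {y : N} (h : ∀ i, ∀ a ∈ T i, a ⊗ₜ y ∈ p) : x ⊗ₜ y ∈ p :=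
  (iSup_le h : ⨆ i, T i ≤ p.comap ((TensorProduct.mk R M N).flip y)) hx

theorem tmul_mem_of_mem_iSup_right {T : ι → Submodule R N} {p : Submodule R (M ⊗[R] N)} {x : M}
    {y : N} (hy : y ∈ ⨆ i, T i) (h : ∀ i, ∀ b ∈ T i, x ⊗ₜ b ∈ p) : x ⊗ₜ y ∈ p :=
  (iSup_le h : ⨆ i, T i ≤ p.comap (TensorProduct.mk R M N x)) hy

theorem tmul_eq_mul_tmul_one {A : Type*} [Semiring A] [Algebra R A] (a : A) {b : A}
    (hb : b ∈ (1 : Submodule R A)) : a ⊗ₜ[R] b = (a * b) ⊗ₜ[R] 1 := by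
  obtain ⟨r, rfl⟩ := Submodule.mem_one.1 hb
  rw [← Algebra.commutes, ← Algebra.smul_def, Algebra.algebraMap_eq_smul_one,
    TensorProduct.smul_tmul]

end CommSemiring

section AffineCodim

variable {F V : Type*} [Field F] [AddCommGroup V] [Module F V]

theorem finrank_quotient_inf_le (A B : Submodule F V) [Module.Finite F (V ⧸ A)]
    [Module.Finite F (V ⧸ B)] :
    Module.finrank F (V ⧸ A ⊓ B) ≤ Module.finrank F (V ⧸ A) + Module.finrank F (V ⧸ B) := by
  have hker : LinearMap.ker (A.mkQ.prod B.mkQ) = A ⊓ B := by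
    rw [LinearMap.ker_prod, A.ker_mkQ, B.ker_mkQ]
  rw [← Module.finrank_prod (R := F), ← hker]
  exact LinearMap.finrank_le_finrank_of_injective
    (LinearMap.ker_eq_bot.1 (Submodule.ker_liftQ_eq_bot' _ _ rfl))

theorem finrank_quotient_lt {A B : Submodule F V} (h : A < B) [Module.Finite F (V ⧸ A)] :
    Module.finrank F (V ⧸ B) < Module.finrank F (V ⧸ A) := by
  have hne : B.map A.mkQ ≠ ⊥ := by
    rw [Ne, ← le_bot_iff, Submodule.map_le_iff_le_comap, Submodule.comap_bot, A.ker_mkQ]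
    exact h.not_ge
  have hpos : 0 < Module.finrank F (B.map A.mkQ) :=
    Module.finrank_pos_iff.2 (Submodule.nontrivial_iff_ne_bot.2 hne)
  have hadd := (B.map A.mkQ).finrank_quotient_add_finrank
  rw [(Submodule.quotientQuotientEquivQuotient A B h.le).finrank_eq] at hadd
  omega

variable {X Y : AffineSubspace F V}

theorem direction_inf_of_nonempty (h : ((X ⊓ Y : AffineSubspace F V) : Set V).Nonempty) :
    (X ⊓ Y).direction = X.direction ⊓ Y.direction :=
  AffineSubspace.direction_inf_of_mem_inf h.some_mem

theorem affineCodim_inf_le [Module.Finite F (V ⧸ X.direction)] [Module.Finite F (V ⧸ Y.direction)]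
    (h : ((X ⊓ Y : AffineSubspace F V) : Set V).Nonempty) :
    affineCodim (X ⊓ Y) ≤ affineCodim X + affineCodim Y := by
  rw [affineCodim, direction_inf_of_nonempty h]
  exact finrank_quotient_inf_le _ _

theorem affineCodim_lt [Module.Finite F (V ⧸ X.direction)] (hX : (X : Set V).Nonempty)
    (h : X < Y) : affineCodim Y < affineCodim X :=
  finrank_quotient_lt (AffineSubspace.direction_lt_of_nonempty h hX)

end AffineCodim

namespace HyperplaneArrangement

section Flats

variable {F V : Type*} [Field F] [AddCommGroup V] [Module F V] {𝒜 : HyperplaneArrangement F V}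

@[simp]
theorem inter_nil : inter ([] : List 𝒜.hyperplanes) = ⊤ := rfl

@[simp]
theorem inter_cons (H : 𝒜.hyperplanes) (S : List 𝒜.hyperplanes) :
    inter (H :: S) = H.1 ⊓ inter S := rfl

theorem inter_append (S T : List 𝒜.hyperplanes) : inter (S ++ T) = inter S ⊓ inter T := by
  induction S with
  | nil => simp
  | cons H S ih => rw [List.cons_append, inter_cons, ih, inter_cons, inf_assoc]

theorem le_inter_iff {X : AffineSubspace F V} {S : List 𝒜.hyperplanes} :
    X ≤ inter S ↔ ∀ H ∈ S, X ≤ H.1 := by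
  induction S with
  | nil => simp
  | cons H S ih => simp [ih]

theorem inter_le_inter_eraseIdx (S : List 𝒜.hyperplanes) (k : ℕ) :
    inter S ≤ inter (S.eraseIdx k) :=
  le_inter_iff.2 fun H hH => le_inter_iff.1 le_rfl H (List.mem_of_mem_eraseIdx hH)

theorem finite_quotient_hyperplane (H : 𝒜.hyperplanes) :
    Module.Finite F (V ⧸ H.1.direction) :=
  Module.finite_of_finrank_eq_succ (𝒜.codim_eq_one H.1 H.2)

theorem finite_quotient_inter {S : List 𝒜.hyperplanes} (hS : (inter S : Set V).Nonempty) :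
    Module.Finite F (V ⧸ (inter S).direction) := by
  induction S with
  | nil =>
    rw [inter_nil, AffineSubspace.direction_top]
    infer_instance
  | cons H S ih =>
    rw [inter_cons] at hS ⊢
    rw [direction_inf_of_nonempty hS]
    exact Submodule.CoFG.inf (finite_quotient_hyperplane H) (ih (hS.mono inf_le_right))

theorem affineCodim_inter_le_length {S : List 𝒜.hyperplanes}
    (hS : (inter S : Set V).Nonempty) : affineCodim (inter S) ≤ S.length := by
  induction S with
  | nil =>
    rw [inter_nil, affineCodim, AffineSubspace.direction_top]
    exact (Module.finrank_zero_of_subsingleton).le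
  | cons H S ih =>
    rw [inter_cons] at hS
    have hS' : (inter S : Set V).Nonempty := hS.mono inf_le_right
    have := finite_quotient_hyperplane H
    have := finite_quotient_inter hS'
    have hle := affineCodim_inf_le hS
    have hH := 𝒜.codim_eq_one H.1 H.2
    have := ih hS'
    rw [inter_cons, List.length_cons]
    omega

theorem Dependent.eraseIdx {S : List 𝒜.hyperplanes} (hS : Dependent S) {k : ℕ}
    (h : inter S ≠ inter (S.eraseIdx k)) : Dependent (S.eraseIdx k) := by
  have := finite_quotient_inter hS.1
  have hk : k < S.length := by
    by_contra hk
    exact h (by rw [List.eraseIdx_of_length_le (not_lt.1 hk)])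
  have hlt := affineCodim_lt hS.1 ((inter_le_inter_eraseIdx S k).lt_of_ne h)
  refine ⟨hS.1.mono (inter_le_inter_eraseIdx S k), ?_⟩
  have := hS.2
  rw [List.length_eraseIdx_of_lt hk]
  omega

theorem dependent_cons {H : 𝒜.hyperplanes} {S : List 𝒜.hyperplanes}
    (hS : (inter S : Set V).Nonempty) (hH : inter S ≤ H.1) : Dependent (H :: S) := by
  have h : inter (H :: S) = inter S := inf_eq_right.2 hH
  exact ⟨h ▸ hS, h ▸ Nat.lt_succ_of_le (affineCodim_inter_le_length hS)⟩

theorem exists_val_eq_inter {S : List 𝒜.hyperplanes} (hS : (inter S : Set V).Nonempty) :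
    ∃ X : 𝒜.IntersectionPoset, X.1 = inter S := by
  classical
  refine ⟨⟨inter S, hS, (S.map Subtype.val).toFinset, fun H hH => ?_, ?_⟩, rfl⟩
  · obtain ⟨H, -, rfl⟩ := List.mem_map.1 (List.mem_toFinset.1 hH)
    exact H.2
  · refine eq_of_forall_le_iff fun X => ?_
    simp [Finset.le_inf_iff, le_inter_iff]

theorem IntersectionPoset.exists_inter_eq (X : 𝒜.IntersectionPoset) :
    ∃ S : List 𝒜.hyperplanes, inter S = X.1 := by
  classical
  obtain ⟨B, hB, hX⟩ := X.2.2
  refine ⟨(𝒜.hyperplanes.attach.filter (·.1 ∈ B)).toList, ?_⟩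
  rw [← hX]
  refine eq_of_forall_le_iff fun Y => ?_
  rw [le_inter_iff, Finset.le_inf_iff]
  exact ⟨fun h H hH => h ⟨H, hB hH⟩ (by simpa using hH), fun h H hH => h H.1 (by simpa using hH)⟩

theorem IntersectionPoset.exists_val_eq_inf (X Y : 𝒜.IntersectionPoset)
    (h : ((X.1 ⊓ Y.1 : AffineSubspace F V) : Set V).Nonempty) :
    ∃ Z : 𝒜.IntersectionPoset, Z.1 = X.1 ⊓ Y.1 := by
  obtain ⟨S, hS⟩ := X.exists_inter_eq
  obtain ⟨T, hT⟩ := Y.exists_inter_eq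
  rw [← hS, ← hT, ← inter_append] at h ⊢
  exact exists_val_eq_inter h

theorem IntersectionPoset.exists_val_eq_hyperplane_inf (X : 𝒜.IntersectionPoset)
    {H : 𝒜.hyperplanes} (h : ((H.1 ⊓ X.1 : AffineSubspace F V) : Set V).Nonempty) :
    ∃ Y : 𝒜.IntersectionPoset, Y.1 = H.1 ⊓ X.1 := by
  obtain ⟨S, hS⟩ := X.exists_inter_eq
  rw [← hS, ← inter_cons] at h ⊢
  exact exists_val_eq_inter h

theorem IntersectionPoset.val_eq_hyperplane_inf_of_covBy {X Y : 𝒜.IntersectionPoset}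
    {H : 𝒜.hyperplanes} (h : X ⋖ Y) (hY : Y.1 ≤ H.1) (hX : ¬ X.1 ≤ H.1) :
    Y.1 = H.1 ⊓ X.1 := by
  have hle : Y.1 ≤ H.1 ⊓ X.1 := le_inf hY h.le
  obtain ⟨Z, hZ⟩ := X.exists_val_eq_hyperplane_inf (Y.2.1.mono hle)
  have hXZ : X ≤ Z := show Z.1 ≤ X.1 from hZ ▸ inf_le_right
  have hZY : Z ≤ Y := show Y.1 ≤ Z.1 from hZ ▸ hle
  obtain rfl | rfl := h.eq_or_eq hXZ hZY
  · exact absurd (hZ ▸ inf_le_left) hX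
  · exact hZ

theorem IntersectionPoset.exists_hyperplane_of_ne_bot {X : 𝒜.IntersectionPoset} (hX : X ≠ ⊥) :
    ∃ H : 𝒜.hyperplanes, X.1 ≤ H.1 := by
  obtain ⟨S, hS⟩ := X.exists_inter_eq
  match S, hS with
  | [], hS => exact absurd (Subtype.ext hS.symm) hX
  | H :: S, hS => exact ⟨H, hS ▸ inf_le_left⟩

instance (X : 𝒜.IntersectionPoset) : Module.Finite F (V ⧸ X.1.direction) := by
  obtain ⟨S, hS⟩ := X.exists_inter_eq
  rw [← hS]
  exact finite_quotient_inter (hS ▸ X.2.1)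

theorem rank_strictMono : StrictMono (rank : 𝒜.IntersectionPoset → ℕ) := fun X Y h =>
  affineCodim_lt Y.2.1 (show Y.1 < X.1 from h)

instance : WellFoundedLT 𝒜.IntersectionPoset := rank_strictMono.wellFoundedLT

theorem IntersectionPoset.eq_of_le_of_rank_le {X Y : 𝒜.IntersectionPoset} (h : X ≤ Y)
    (hr : rank Y ≤ rank X) : X = Y :=
  h.eq_of_not_lt fun hlt => (rank_strictMono hlt).not_ge hr

end Flats

section ExteriorAlgebra

open CliffordAlgebra (involute)

variable {F V K : Type*} [Field F] [AddCommGroup V] [Module F V] [CommRing K]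
  {𝒜 : HyperplaneArrangement F V}

theorem e_nil : e K ([] : List 𝒜.hyperplanes) = 1 := by simp only [e, List.map_nil, List.prod_nil]

theorem e_append (S T : List 𝒜.hyperplanes) : e K (S ++ T) = e K S * e K T := by
  simp only [e, List.map_append, List.prod_append]

theorem e_cons (H : 𝒜.hyperplanes) (S : List 𝒜.hyperplanes) :
    e K (H :: S) = e K [H] * e K S :=
  e_append [H] S

theorem e_singleton (H : 𝒜.hyperplanes) :
    e K [H] = ExteriorAlgebra.ι K (Finsupp.single H (1 : K)) := by
  simp only [e, List.map_cons, List.map_nil, List.prod_singleton]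

theorem e_singleton_mul_self (H : 𝒜.hyperplanes) : e K [H] * e K [H] = 0 := by
  rw [e_singleton, ExteriorAlgebra.ι_sq_zero]

theorem involute_e_singleton (H : 𝒜.hyperplanes) :
    involute (e K [H]) = -e K [H] := by
  rw [e_singleton]
  exact CliffordAlgebra.involute_ι _

theorem involute_e (S : List 𝒜.hyperplanes) :
    involute (e K S) = (-1 : K) ^ S.length • e K S := by
  induction S with
  | nil => rw [e_nil, map_one, List.length_nil, pow_zero, one_smul]
  | cons H S ih =>
    rw [e_cons, map_mul, involute_e_singleton, ih, List.length_cons, pow_succ, mul_neg_one,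
      neg_smul, mul_smul_comm, neg_mul, smul_neg]

theorem ι_mul_eq_involute_mul_ι {M : Type*} [AddCommGroup M] [Module K M] (m : M)
    (x : ExteriorAlgebra K M) :
    ExteriorAlgebra.ι K m * x = involute x * ExteriorAlgebra.ι K m := by
  induction x using CliffordAlgebra.left_induction with
  | algebraMap r => rw [AlgHom.commutes, Algebra.commutes]
  | add x y hx hy => rw [mul_add, hx, hy, map_add, add_mul]
  | ι_mul x v hx =>
    have hswap : ExteriorAlgebra.ι K m * ExteriorAlgebra.ι K v =
        -(ExteriorAlgebra.ι K v * ExteriorAlgebra.ι K m) :=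
      eq_neg_of_add_eq_zero_left (ExteriorAlgebra.ι_add_mul_swap m v)
    change _ * (ExteriorAlgebra.ι K v * x) = involute (ExteriorAlgebra.ι K v * x) * _
    rw [← mul_assoc, hswap, neg_mul, mul_assoc, hx, map_mul, ← neg_mul, ← mul_assoc]
    exact congrArg (· * _ * _) (CliffordAlgebra.involute_ι v).symm

theorem exteriorPower_eq_span (p : ℕ) :
    ⋀[K]^p (𝒜.hyperplanes →₀ K) =
      Submodule.span K (e K '' {S : List 𝒜.hyperplanes | S.length = p}) := by
  induction p with
  | zero => simp [List.length_eq_zero_iff, e_nil, Submodule.one_eq_span]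
  | succ p ih =>
    have hι : LinearMap.range (ExteriorAlgebra.ι K) =
        Submodule.span K (Set.range fun H : 𝒜.hyperplanes => e K [H]) := by
      simp only [e_singleton]
      rw [LinearMap.range_eq_map, ← Finsupp.basisSingleOne.span_eq, Submodule.map_span,
        ← Set.range_comp]
      rfl
    rw [ExteriorAlgebra.exteriorPower, pow_succ', ← ExteriorAlgebra.exteriorPower, ih, hι,
      Submodule.span_mul_span]
    congr 1
    ext x
    constructor
    · rintro ⟨_, ⟨H, rfl⟩, _, ⟨S, hS, rfl⟩, rfl⟩
      exact ⟨H :: S, congrArg (· + 1) hS, e_cons H S⟩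
    · rintro ⟨_ | ⟨H, S⟩, hS, rfl⟩
      · simp at hS
      · exact ⟨_, ⟨H, rfl⟩, _, ⟨S, Nat.succ.inj hS, rfl⟩, (e_cons H S).symm⟩

theorem boundary_mul (x y : 𝒜.Ext K) :
    boundary 𝒜 K (x * y) = boundary 𝒜 K x * y + involute x * boundary 𝒜 K y :=
  contractLeft_mul _ x y

theorem boundary_boundary (x : 𝒜.Ext K) : boundary 𝒜 K (boundary 𝒜 K x) = 0 :=
  CliffordAlgebra.contractLeft_contractLeft _ x

theorem boundary_involute (x : 𝒜.Ext K) :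
    boundary 𝒜 K (involute x) = -involute (boundary 𝒜 K x) :=
  contractLeft_involute _ x

theorem boundary_e_singleton (H : 𝒜.hyperplanes) : boundary 𝒜 K (e K [H]) = 1 := by
  simp [boundary_e, e_nil]

theorem e_singleton_mul_boundary_e_cons (H : 𝒜.hyperplanes) (S : List 𝒜.hyperplanes) :
    e K [H] * boundary 𝒜 K (e K (H :: S)) = e K (H :: S) := by
  rw [e_cons H S, boundary_mul, boundary_e_singleton, one_mul, involute_e_singleton, neg_mul,
    mul_add, mul_neg, ← mul_assoc, e_singleton_mul_self, zero_mul, neg_zero, add_zero]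

open Classical in
/-- The projection of the exterior algebra of `𝒜` onto that of its localization
`𝒜_X = {H ∈ 𝒜 : X ⊆ H}`, killing the generators `e_H` with `X ⊄ H`. -/
noncomputable def extLocalize (X : 𝒜.IntersectionPoset) : 𝒜.Ext K →ₐ[K] 𝒜.Ext K :=
  ExteriorAlgebra.map (Finsupp.linearCombination K fun H : 𝒜.hyperplanes =>
    if X.1 ≤ H.1 then Finsupp.single H (1 : K) else 0)

variable {X : 𝒜.IntersectionPoset} {S : List 𝒜.hyperplanes}

theorem extLocalize_e_of_le (h : X.1 ≤ inter S) : extLocalize X (e K S) = e K S := by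
  induction S with
  | nil => rw [e_nil, map_one]
  | cons H S ih =>
    rw [e_cons, map_mul, ih (h.trans inf_le_right), e_singleton, extLocalize,
      ExteriorAlgebra.map_apply_ι, Finsupp.linearCombination_single, one_smul,
      if_pos (h.trans inf_le_left)]

theorem extLocalize_e_of_not_le (h : ¬ X.1 ≤ inter S) : extLocalize X (e K S) = 0 := by
  obtain ⟨H, hH, hXH⟩ : ∃ H ∈ S, ¬ X.1 ≤ H.1 := by simpa [le_inter_iff] using h
  obtain ⟨T, U, rfl⟩ := List.append_of_mem hH
  rw [e_append, e_cons, map_mul, map_mul, e_singleton, extLocalize, ExteriorAlgebra.map_apply_ι,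
    Finsupp.linearCombination_single, one_smul, if_neg hXH, map_zero, zero_mul, mul_zero]

theorem extLocalize_boundary_e_of_le (h : X.1 ≤ inter S) :
    extLocalize X (boundary 𝒜 K (e K S)) = boundary 𝒜 K (e K S) := by
  rw [boundary_e, map_sum]
  refine Finset.sum_congr rfl fun k _ => ?_
  rw [map_smul, extLocalize_e_of_le (h.trans (inter_le_inter_eraseIdx S k))]

theorem extLocalize_boundary_e_mem_span (hS : Dependent S) (h : ¬ X.1 ≤ inter S) :
    extLocalize X (boundary 𝒜 K (e K S)) ∈ Submodule.span K (e K '' {T | Dependent T}) := by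
  rw [boundary_e, map_sum]
  refine Submodule.sum_mem _ fun k _ => ?_
  rw [map_smul]
  refine Submodule.smul_mem _ _ ?_
  by_cases hk : X.1 ≤ inter (S.eraseIdx k)
  · -- Omitting the `k`-th hyperplane enlarges the intersection, as only then does it contain `X`.
    rw [extLocalize_e_of_le hk]
    exact Submodule.subset_span ⟨_, hS.eraseIdx fun heq => h (heq ▸ hk), rfl⟩
  · rw [extLocalize_e_of_not_le hk]
    exact zero_mem _

end ExteriorAlgebra

section Relations

open CliffordAlgebra (involute)

variable {F V K : Type*} [Field F] [AddCommGroup V] [Module F V] [CommRing K]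
  {𝒜 : HyperplaneArrangement F V} {S : List 𝒜.hyperplanes}

theorem osProj_surjective : Function.Surjective (osProj 𝒜 K) :=
  Ideal.Quotient.mkₐ_surjective K _

theorem osProj_eq_zero_iff {x : 𝒜.Ext K} : osProj 𝒜 K x = 0 ↔ x ∈ osIdeal 𝒜 K :=
  Ideal.Quotient.eq_zero_iff_mem.trans TwoSidedIdeal.mem_asIdeal

theorem osProj_e_of_not_nonempty (hS : ¬ (inter S : Set V).Nonempty) :
    osProj 𝒜 K (e K S) = 0 :=
  osProj_eq_zero_iff.2 (TwoSidedIdeal.subset_span (Or.inl ⟨S, hS, rfl⟩))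

theorem osProj_boundary_e_of_dependent (hS : Dependent S) :
    osProj 𝒜 K (boundary 𝒜 K (e K S)) = 0 :=
  osProj_eq_zero_iff.2 (TwoSidedIdeal.subset_span (Or.inr ⟨S, hS, rfl⟩))

theorem osProj_e_of_dependent (hS : Dependent S) : osProj 𝒜 K (e K S) = 0 := by
  match S, hS with
  | [], hS => exact absurd hS.2 (Nat.not_lt_zero _)
  | H :: S, hS =>
    rw [← e_singleton_mul_boundary_e_cons, map_mul, osProj_boundary_e_of_dependent hS, mul_zero]

theorem algHom_eq_zero_of_osProj_eq_zero {B : Type*} [Ring B] [Algebra K B] (f : 𝒜.Ext K →ₐ[K] B)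
    (hempty : ∀ S : List 𝒜.hyperplanes, ¬ (inter S : Set V).Nonempty → f (e K S) = 0)
    (hdep : ∀ S : List 𝒜.hyperplanes, Dependent S → f (boundary 𝒜 K (e K S)) = 0)
    {x : 𝒜.Ext K} (hx : osProj 𝒜 K x = 0) : f x = 0 := by
  suffices h : osIdeal 𝒜 K ≤ TwoSidedIdeal.ker f from
    (TwoSidedIdeal.mem_ker f).1 (h (osProj_eq_zero_iff.1 hx))
  rw [osIdeal, TwoSidedIdeal.span_le]
  rintro _ (⟨S, hS, rfl⟩ | ⟨S, hS, rfl⟩)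
  · exact (TwoSidedIdeal.mem_ker f).2 (hempty S hS)
  · exact (TwoSidedIdeal.mem_ker f).2 (hdep S hS)

theorem osProj_involute_eq_zero {x : 𝒜.Ext K} (hx : osProj 𝒜 K x = 0) :
    osProj 𝒜 K (involute x) = 0 := by
  refine algHom_eq_zero_of_osProj_eq_zero ((osProj 𝒜 K).comp involute)
    (fun S hS => ?_) (fun S hS => ?_) hx
  · rw [AlgHom.comp_apply, involute_e, map_smul, osProj_e_of_not_nonempty hS, smul_zero]
  · rw [AlgHom.comp_apply, ← neg_neg (involute _), ← boundary_involute, involute_e, map_smul,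
      map_neg, map_smul, osProj_boundary_e_of_dependent hS, smul_zero, neg_zero]

variable (X : 𝒜.IntersectionPoset)

theorem extLocalize_e_of_not_nonempty (hS : ¬ (inter S : Set V).Nonempty) :
    extLocalize X (e K S) = 0 :=
  extLocalize_e_of_not_le fun h => hS (X.2.1.mono h)

theorem osProj_extLocalize_eq_zero {x : 𝒜.Ext K} (hx : osProj 𝒜 K x = 0) :
    osProj 𝒜 K (extLocalize X x) = 0 := by
  refine algHom_eq_zero_of_osProj_eq_zero ((osProj 𝒜 K).comp (extLocalize X))
    (fun S hS => ?_) (fun S hS => ?_) hx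
  · rw [AlgHom.comp_apply, extLocalize_e_of_not_nonempty X hS, map_zero]
  · rw [AlgHom.comp_apply]
    by_cases h : X.1 ≤ inter S
    · rw [extLocalize_boundary_e_of_le h, osProj_boundary_e_of_dependent hS]
    · refine (Submodule.span_le (p := LinearMap.ker (osProj 𝒜 K).toLinearMap)).2 ?_
        (extLocalize_boundary_e_mem_span hS h)
      rintro _ ⟨T, hT, rfl⟩
      exact osProj_e_of_dependent hT

theorem osProj_boundary_extLocalize_boundary_e (hS : Dependent S) :
    osProj 𝒜 K (boundary 𝒜 K (extLocalize X (boundary 𝒜 K (e K S)))) = 0 := by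
  by_cases h : X.1 ≤ inter S
  · rw [extLocalize_boundary_e_of_le h, boundary_boundary, map_zero]
  · refine (Submodule.span_le
      (p := LinearMap.ker ((osProj 𝒜 K).toLinearMap ∘ₗ boundary 𝒜 K))).2 ?_
      (extLocalize_boundary_e_mem_span hS h)
    rintro _ ⟨T, hT, rfl⟩
    exact osProj_boundary_e_of_dependent hT

theorem osProj_boundary_extLocalize_eq_zero {x : 𝒜.Ext K} (hx : osProj 𝒜 K x = 0) :
    osProj 𝒜 K (boundary 𝒜 K (extLocalize X x)) = 0 := by
  rw [osProj_eq_zero_iff] at hx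
  induction hx using TwoSidedIdeal.span_induction with
  | mem x hx =>
    obtain ⟨S, hS, rfl⟩ | ⟨S, hS, rfl⟩ := hx
    · rw [extLocalize_e_of_not_nonempty X hS, map_zero, map_zero]
    · exact osProj_boundary_extLocalize_boundary_e X hS
  | zero => simp only [map_zero]
  | add x y _ _ hx hy => simp only [map_add, hx, hy, add_zero]
  | neg x _ hx => simp only [map_neg, hx, neg_zero]
  | left_absorb a x hx' hx =>
    have hρ := osProj_extLocalize_eq_zero X (osProj_eq_zero_iff.2 hx')
    simp only [map_mul, boundary_mul, map_add, hρ, hx, mul_zero, add_zero]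
  | right_absorb a x hx' hx =>
    have hρ := osProj_involute_eq_zero (osProj_extLocalize_eq_zero X (osProj_eq_zero_iff.2 hx'))
    simp only [map_mul, boundary_mul, map_add, hρ, hx, zero_mul, add_zero]

end Relations

section Operators

open CliffordAlgebra (involute)

variable {F V K : Type*} [Field F] [AddCommGroup V] [Module F V] [CommRing K]
  {𝒜 : HyperplaneArrangement F V}

/-- The descent to the Orlik–Solomon algebra of a linear map on the exterior algebra that vanishes
on `I(𝒜)`. -/
noncomputable def osLift {N : Type*} [AddCommGroup N] [Module K N] (f : 𝒜.Ext K →ₗ[K] N)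
    (hf : ∀ x, osProj 𝒜 K x = 0 → f x = 0) : 𝒜.OSAlgebra K →ₗ[K] N :=
  ((osIdeal 𝒜 K).asIdeal.restrictScalars K).liftQ f
    (fun x hx => hf x (Ideal.Quotient.eq_zero_iff_mem.2 hx)) ∘ₗ
    (Submodule.Quotient.restrictScalarsEquiv K (osIdeal 𝒜 K).asIdeal).symm.toLinearMap

/-- The grade involution `σ` of the Orlik–Solomon algebra, `(-1)^p` in degree `p`. -/
noncomputable def osInvolute : 𝒜.OSAlgebra K →ₗ[K] 𝒜.OSAlgebra K :=
  osLift ((osProj 𝒜 K).toLinearMap ∘ₗ involute.toLinearMap) fun _ => osProj_involute_eq_zero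

/-- The localization `ρ_X` of the Orlik–Solomon algebra at a flat `X`, the projection onto the
subalgebra of the arrangement `𝒜_X = {H ∈ 𝒜 : X ⊆ H}`. -/
noncomputable def osLocalize (X : 𝒜.IntersectionPoset) : 𝒜.OSAlgebra K →ₗ[K] 𝒜.OSAlgebra K :=
  osLift ((osProj 𝒜 K).toLinearMap ∘ₗ (extLocalize X).toLinearMap)
    fun _ => osProj_extLocalize_eq_zero X

/-- The derivation `∂_X`: localization at a flat `X` followed by the boundary map. For an affine
arrangement the boundary map itself does not descend to the Orlik–Solomon algebra, but after
localization all hyperplanes have a common point and it does. -/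
noncomputable def osBoundary (X : 𝒜.IntersectionPoset) : 𝒜.OSAlgebra K →ₗ[K] 𝒜.OSAlgebra K :=
  osLift ((osProj 𝒜 K).toLinearMap ∘ₗ boundary 𝒜 K ∘ₗ (extLocalize X).toLinearMap)
    fun _ => osProj_boundary_extLocalize_eq_zero X

theorem osInvolute_osInvolute (a : 𝒜.OSAlgebra K) : osInvolute (osInvolute a) = a := by
  obtain ⟨x, rfl⟩ := osProj_surjective a
  exact congrArg (osProj 𝒜 K) (CliffordAlgebra.involute_involute x)

theorem osBoundary_mul (X : 𝒜.IntersectionPoset) (a b : 𝒜.OSAlgebra K) :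
    osBoundary X (a * b) =
      osBoundary X a * osLocalize X b + osInvolute (osLocalize X a) * osBoundary X b := by
  obtain ⟨x, rfl⟩ := osProj_surjective a
  obtain ⟨y, rfl⟩ := osProj_surjective b
  calc osProj 𝒜 K (boundary 𝒜 K (extLocalize X (x * y)))
      = osProj 𝒜 K (boundary 𝒜 K (extLocalize X x) * extLocalize X y +
          involute (extLocalize X x) * boundary 𝒜 K (extLocalize X y)) := by
        rw [map_mul, boundary_mul]
    _ = _ := by rw [map_add, map_mul, map_mul]; rfl

end Operators

section Components

variable {F V K : Type*} [Field F] [AddCommGroup V] [Module F V] [CommRing K]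
  {𝒜 : HyperplaneArrangement F V} {X Y : 𝒜.IntersectionPoset} {S : List 𝒜.hyperplanes}
  {H : 𝒜.hyperplanes}

variable (K) in
/-- The image of `e_S` in the Orlik–Solomon algebra. -/
noncomputable def osE (S : List 𝒜.hyperplanes) : 𝒜.OSAlgebra K := osProj 𝒜 K (e K S)

theorem osE_nil : osE K ([] : List 𝒜.hyperplanes) = 1 := by rw [osE, e_nil, map_one]

theorem osE_append (S T : List 𝒜.hyperplanes) : osE K (S ++ T) = osE K S * osE K T := by
  rw [osE, e_append, map_mul]; rfl

theorem osE_singleton_mul (H : 𝒜.hyperplanes) (a : 𝒜.OSAlgebra K) :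
    osE K [H] * a = osInvolute a * osE K [H] := by
  obtain ⟨x, rfl⟩ := osProj_surjective a
  rw [osE, ← map_mul, e_singleton, ι_mul_eq_involute_mul_ι, map_mul]
  rfl

theorem osInvolute_osE (S : List 𝒜.hyperplanes) :
    osInvolute (osE K S) = (-1 : K) ^ S.length • osE K S := by
  rw [osE, ← map_smul, ← involute_e]
  rfl

theorem osBoundary_osE (h : X.1 ≤ inter S) :
    osBoundary X (osE K S) =
      ∑ k ∈ Finset.range S.length, (-1 : K) ^ k • osE K (S.eraseIdx k) := by
  change osProj 𝒜 K (boundary 𝒜 K (extLocalize X (e K S))) = _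
  simp only [extLocalize_e_of_le h, boundary_e, map_sum, map_smul, osE]

theorem osComponent_eq_span (X : 𝒜.IntersectionPoset) :
    osComponent K X = Submodule.span K (osE K '' {S | inter S = X.1}) := by
  rw [osComponent, extComponent, Submodule.map_span]
  congr 1
  ext a
  constructor
  · rintro ⟨_, ⟨S, hS, rfl⟩, rfl⟩
    exact ⟨S, hS, rfl⟩
  · rintro ⟨S, hS, rfl⟩
    exact ⟨e K S, ⟨S, hS, rfl⟩, rfl⟩

theorem osE_mem_osComponent (hS : inter S = X.1) : osE K S ∈ osComponent K X :=
  osComponent_eq_span (K := K) X ▸ Submodule.subset_span ⟨S, hS, rfl⟩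

theorem osComponent_le_iff {p : Submodule K (𝒜.OSAlgebra K)} :
    osComponent K X ≤ p ↔ ∀ S : List 𝒜.hyperplanes, inter S = X.1 → osE K S ∈ p := by
  rw [osComponent_eq_span, Submodule.span_le, Set.image_subset_iff]
  rfl

theorem osE_eq_zero_or_length_eq (hS : inter S = X.1) : osE K S = 0 ∨ S.length = rank X := by
  have hne : (inter S : Set V).Nonempty := hS ▸ X.2.1
  refine or_iff_not_imp_right.2 fun hlen => osProj_e_of_dependent ⟨hne, ?_⟩
  exact (affineCodim_inter_le_length hne).lt_of_ne fun h => hlen (by rw [← h, hS]; rfl)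

theorem osE_mem_iSup_osComponent (S : List 𝒜.hyperplanes) :
    osE K S ∈ ⨆ (X : 𝒜.IntersectionPoset) (_ : rank X = S.length), osComponent K X := by
  by_cases hS : (inter S : Set V).Nonempty
  · obtain ⟨X, hX⟩ := exists_val_eq_inter hS
    obtain h | h := osE_eq_zero_or_length_eq (K := K) hX.symm
    · rw [h]
      exact zero_mem _
    · exact Submodule.mem_iSup_of_mem X
        (Submodule.mem_iSup_of_mem h.symm (osE_mem_osComponent hX.symm))
  · rw [osE, osProj_e_of_not_nonempty hS]
    exact zero_mem _

theorem osDegree_eq_span (p : ℕ) :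
    osDegree 𝒜 K p = Submodule.span K (osE K '' {S | S.length = p}) := by
  rw [osDegree, exteriorPower_eq_span, Submodule.map_span, ← Set.image_comp]
  rfl

theorem osDegree_eq_iSup (p : ℕ) :
    osDegree 𝒜 K p = ⨆ (X : 𝒜.IntersectionPoset) (_ : rank X = p), osComponent K X := by
  rw [osDegree_eq_span]
  refine le_antisymm (Submodule.span_le.2 ?_)
    (iSup₂_le fun X hX => osComponent_le_iff.2 fun S hS => ?_)
  · rintro _ ⟨S, rfl, rfl⟩
    exact osE_mem_iSup_osComponent S
  · obtain h | h := osE_eq_zero_or_length_eq (K := K) hS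
    · rw [h]
      exact zero_mem _
    · exact Submodule.subset_span ⟨S, h.trans hX, rfl⟩

theorem osComponent_le_osDegree (X : 𝒜.IntersectionPoset) :
    osComponent K X ≤ osDegree 𝒜 K (rank X) := by
  rw [osDegree_eq_iSup]
  exact le_iSup₂ (f := fun Y (_ : rank Y = rank X) => osComponent K Y) X rfl

theorem osDegree_mul_le (p q : ℕ) :
    osDegree 𝒜 K p * osDegree 𝒜 K q ≤ osDegree 𝒜 K (p + q) := by
  simp only [osDegree_eq_span, Submodule.span_mul_span]
  refine Submodule.span_mono ?_
  rintro _ ⟨_, ⟨S, rfl, rfl⟩, _, ⟨T, rfl, rfl⟩, rfl⟩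
  exact ⟨S ++ T, List.length_append, osE_append S T⟩

theorem iSup_osDegree : ⨆ p, osDegree 𝒜 K p = ⊤ := by
  have h : ⨆ p, ⋀[K]^p (𝒜.hyperplanes →₀ K) = ⊤ :=
    (DirectSum.Decomposition.isInternal fun p => ⋀[K]^p (𝒜.hyperplanes →₀ K)).submodule_iSup_eq_top
  simp only [osDegree]
  rw [← Submodule.map_iSup, h, Submodule.map_top]
  exact LinearMap.range_eq_top.2 osProj_surjective

theorem iSup_osComponent : ⨆ X : 𝒜.IntersectionPoset, osComponent K X = ⊤ := by
  refine top_unique ((iSup_osDegree (K := K) (𝒜 := 𝒜)).ge.trans (iSup_le fun p => ?_))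
  rw [osDegree_eq_iSup]
  exact iSup_mono fun X => iSup_le fun _ => le_rfl

theorem osComponent_bot : osComponent K (⊥ : 𝒜.IntersectionPoset) = 1 := by
  refine le_antisymm (osComponent_le_iff.2 fun S hS => ?_) ?_
  · obtain h | h := osE_eq_zero_or_length_eq (K := K) hS
    · rw [h]
      exact zero_mem _
    · obtain rfl : S = [] := by
        rw [← List.length_eq_zero_iff, h, ← Nat.le_zero]
        exact affineCodim_inter_le_length (S := ([] : List 𝒜.hyperplanes)) Set.univ_nonempty
      exact osE_nil (K := K) (𝒜 := 𝒜) ▸ Submodule.one_le.1 le_rfl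
  · exact Submodule.one_le.2 (osE_nil (K := K) (𝒜 := 𝒜) ▸ osE_mem_osComponent rfl)

theorem osComponent_mul_le {Z : 𝒜.IntersectionPoset} (hZ : Z.1 = X.1 ⊓ Y.1) :
    osComponent K X * osComponent K Y ≤ osComponent K Z := by
  rw [osComponent_eq_span X, osComponent_eq_span Y, Submodule.span_mul_span, Submodule.span_le]
  rintro _ ⟨_, ⟨S, hS, rfl⟩, _, ⟨T, hT, rfl⟩, rfl⟩
  change osE K S * osE K T ∈ osComponent K Z
  rw [← osE_append]
  exact osE_mem_osComponent (by rw [inter_append, hS, hT, hZ])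

theorem osE_singleton_mul_mem (hY : Y.1 = H.1 ⊓ X.1) {a : 𝒜.OSAlgebra K}
    (ha : a ∈ osComponent K X) : osE K [H] * a ∈ osComponent K Y := by
  suffices h : osComponent K X ≤ (osComponent K Y).comap (LinearMap.mulLeft K (osE K [H])) from h ha
  refine osComponent_le_iff.2 fun S hS => ?_
  rw [Submodule.mem_comap, LinearMap.mulLeft_apply, ← osE_append]
  exact osE_mem_osComponent (by rw [List.singleton_append, inter_cons, hS, hY])

theorem osE_singleton_mul_eq_zero (h : X.1 ≤ H.1) {a : 𝒜.OSAlgebra K}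
    (ha : a ∈ osComponent K X) : osE K [H] * a = 0 := by
  suffices h : osComponent K X ≤ LinearMap.ker (LinearMap.mulLeft K (osE K [H])) from h ha
  refine osComponent_le_iff.2 fun S hS => ?_
  rw [LinearMap.mem_ker, LinearMap.mulLeft_apply, ← osE_append]
  exact osProj_e_of_dependent (dependent_cons (hS ▸ X.2.1) (hS ▸ h))

theorem osInvolute_mem {a : 𝒜.OSAlgebra K} (ha : a ∈ osComponent K X) :
    osInvolute a ∈ osComponent K X := by
  suffices h : osComponent K X ≤ (osComponent K X).comap osInvolute from h ha
  refine osComponent_le_iff.2 fun S hS => ?_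
  rw [Submodule.mem_comap, osInvolute_osE]
  exact Submodule.smul_mem _ _ (osE_mem_osComponent hS)

theorem osLocalize_eq_self (h : Y ≤ X) {a : 𝒜.OSAlgebra K} (ha : a ∈ osComponent K Y) :
    osLocalize X a = a := by
  suffices h : osComponent K Y ≤ LinearMap.eqLocus (osLocalize X) LinearMap.id from h ha
  refine osComponent_le_iff.2 fun S hS => ?_
  exact congrArg (osProj 𝒜 K) (extLocalize_e_of_le (hS ▸ h))

theorem osLocalize_eq_zero (h : ¬ Y ≤ X) {a : 𝒜.OSAlgebra K} (ha : a ∈ osComponent K Y) :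
    osLocalize X a = 0 := by
  suffices h : osComponent K Y ≤ LinearMap.ker (osLocalize X) from h ha
  refine osComponent_le_iff.2 fun S hS => ?_
  refine (congrArg (osProj 𝒜 K) (extLocalize_e_of_not_le ?_)).trans (map_zero _)
  rwa [hS]

theorem osLocalize_osE_singleton (h : X.1 ≤ H.1) : osLocalize X (osE K [H]) = osE K [H] :=
  congrArg (osProj 𝒜 K) (extLocalize_e_of_le (S := [H]) (le_inf h le_top))

theorem osBoundary_osE_singleton (h : X.1 ≤ H.1) : osBoundary X (osE K [H]) = 1 := by
  rw [osBoundary_osE (S := [H]) (le_inf h le_top)]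
  simp [osE_nil]

theorem osE_singleton_mul_osBoundary (hYX : Y ≤ X) (hH : Y.1 ≤ H.1) {a : 𝒜.OSAlgebra K}
    (ha : a ∈ osComponent K Y) : osE K [H] * osBoundary X a = a := by
  have hXH : X.1 ≤ H.1 := le_trans (show X.1 ≤ Y.1 from hYX) hH
  have h := osBoundary_mul X (osE K [H]) a
  rw [osE_singleton_mul_eq_zero hH ha, map_zero, osBoundary_osE_singleton hXH, one_mul,
    osLocalize_eq_self hYX ha, osLocalize_osE_singleton hXH, osInvolute_osE, List.length_singleton,
    pow_one, neg_one_smul, neg_mul, ← sub_eq_add_neg] at h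
  exact (sub_eq_zero.1 h.symm).symm

theorem covBy_of_rank_add_one_eq (h : X ≤ Y) (hr : rank X + 1 = rank Y) : X ⋖ Y := by
  refine ⟨h.lt_of_ne fun h => ?_, fun Z hXZ hZY => ?_⟩
  · rw [h] at hr
    exact Nat.succ_ne_self _ hr
  · have := rank_strictMono hXZ
    have := rank_strictMono hZY
    omega

theorem osBoundary_mem (hYX : Y ≤ X) {a : 𝒜.OSAlgebra K} (ha : a ∈ osComponent K Y) :
    osBoundary X a ∈ ⨆ Z : {Z // Z ⋖ Y}, osComponent K Z.1 := by
  suffices h : osComponent K Y ≤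
      (⨆ Z : {Z // Z ⋖ Y}, osComponent K Z.1).comap (osBoundary X) from h ha
  refine osComponent_le_iff.2 fun S hS => ?_
  rw [Submodule.mem_comap]
  obtain h | hlen := osE_eq_zero_or_length_eq (K := K) hS
  · rw [h, map_zero]
    exact zero_mem _
  rw [osBoundary_osE (hS ▸ hYX)]
  refine Submodule.sum_mem _ fun k hk => Submodule.smul_mem _ _ ?_
  have hle : inter S ≤ inter (S.eraseIdx k) := inter_le_inter_eraseIdx S k
  obtain ⟨Z, hZ⟩ := exists_val_eq_inter (Set.Nonempty.mono hle (hS ▸ Y.2.1))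
  obtain h | h := osE_eq_zero_or_length_eq (K := K) hZ.symm
  · rw [h]
    exact zero_mem _
  have hZY : Z ⋖ Y := by
    refine covBy_of_rank_add_one_eq (show Y.1 ≤ Z.1 from hS ▸ hZ ▸ hle) ?_
    rw [← h, ← hlen, List.length_eraseIdx_add_one (Finset.mem_range.1 hk)]
  exact Submodule.mem_iSup_of_mem ⟨Z, hZY⟩ (osE_mem_osComponent hZ.symm)

end Components

section Brieskorn

variable {F V K : Type*} [Field F] [AddCommGroup V] [Module F V] [CommRing K]
  {𝒜 : HyperplaneArrangement F V}

theorem iSupIndep_osComponent : iSupIndep (osComponent K (𝒜 := 𝒜)) := by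
  rw [iSupIndep_iff_finsetSum_eq_zero_imp_eq_zero]
  intro s a ha hsum X
  induction X using WellFoundedLT.induction with
  | ind X ih =>
    intro hX
    calc a X = osLocalize X (a X) := (osLocalize_eq_self le_rfl (ha X hX)).symm
      _ = ∑ Y ∈ s, osLocalize X (a Y) := by
        symm
        refine Finset.sum_eq_single_of_mem X hX fun Y hY hne => ?_
        by_cases h : Y ≤ X
        · rw [ih Y (h.lt_of_ne hne) hY, map_zero]
        · exact osLocalize_eq_zero h (ha Y hY)
      _ = 0 := by rw [← map_sum, hsum, map_zero]

theorem isInternal_osComponent [DecidableEq 𝒜.IntersectionPoset] :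
    DirectSum.IsInternal fun X : 𝒜.IntersectionPoset => osComponent K X :=
  (DirectSum.isInternal_submodule_iff_iSupIndep_and_iSup_eq_top _).2
    ⟨iSupIndep_osComponent, iSup_osComponent⟩

theorem isInternal_osDegree : DirectSum.IsInternal (osDegree 𝒜 K) := by
  refine (DirectSum.isInternal_submodule_iff_iSupIndep_and_iSup_eq_top _).2 ⟨?_, iSup_osDegree⟩
  simpa only [← osDegree_eq_iSup] using
    iSupIndep_iSup_fiber (iSupIndep_osComponent (K := K) (𝒜 := 𝒜)) rank

end Brieskorn

namespace IsIdealDecomposition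

variable {F V : Type*} [Field F] [AddCommGroup V] [Module F V] {𝒜 : HyperplaneArrangement F V}

theorem comp_equiv {m n : ℕ} {I : Fin m → Set 𝒜.IntersectionPoset} (hD : IsIdealDecomposition I)
    (σ : Fin n ≃ Fin m) : IsIdealDecomposition (I ∘ σ) where
  ideal j := hD.ideal (σ j)
  meet X hX := (hD.meet X hX).imp' σ.symm fun j hj => by
    rwa [Function.comp_apply, σ.apply_symm_apply]
  join X hX := by
    rw [← σ.symm.iInf_comp]
    exact hD.join (X ∘ σ.symm) fun j => by simpa using hX (σ.symm j)
  rank_join X hX := by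
    rw [← σ.symm.iInf_comp, ← σ.symm.sum_comp]
    exact hD.rank_join (X ∘ σ.symm) fun j => by simpa using hX (σ.symm j)

variable {I J : Set 𝒜.IntersectionPoset} {X Y Z W : 𝒜.IntersectionPoset}

theorem swap (hD : IsIdealDecomposition ![I, J]) : IsIdealDecomposition ![J, I] := by
  convert hD.comp_equiv (Equiv.swap 0 1) using 1
  ext j : 1
  fin_cases j <;> rfl

theorem isLowerSet_left (hD : IsIdealDecomposition ![I, J]) : IsLowerSet I := (hD.ideal 0).2

theorem bot_mem_left (hD : IsIdealDecomposition ![I, J]) : ⊥ ∈ I :=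
  (hD.ideal 0).1.elim fun _ hX => hD.isLowerSet_left bot_le hX

theorem exists_val_eq_inf (hD : IsIdealDecomposition ![I, J]) (hY : Y ∈ I) (hZ : Z ∈ J) :
    ∃ X : 𝒜.IntersectionPoset, X.1 = Y.1 ⊓ Z.1 ∧ rank X = rank Y + rank Z := by
  have hmem : ∀ j, ![Y, Z] j ∈ ![I, J] j := Fin.forall_fin_two.2 ⟨hY, hZ⟩
  have hinf : ⨅ j, (![Y, Z] j).1 = Y.1 ⊓ Z.1 :=
    le_antisymm (le_inf (iInf_le _ 0) (iInf_le _ 1))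
      (le_iInf (Fin.forall_fin_two.2 ⟨inf_le_left, inf_le_right⟩))
  obtain ⟨X, hX⟩ := Y.exists_val_eq_inf Z (hinf ▸ hD.join _ hmem)
  refine ⟨X, hX, ?_⟩
  have hrank := hD.rank_join _ hmem
  rwa [hinf, Fin.sum_univ_two, ← hX] at hrank

theorem rank_eq_add (hD : IsIdealDecomposition ![I, J]) (hY : Y ∈ I) (hZ : Z ∈ J)
    (hX : X.1 = Y.1 ⊓ Z.1) : rank X = rank Y + rank Z := by
  obtain ⟨X', hX', hrank⟩ := hD.exists_val_eq_inf hY hZ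
  rwa [show X = X' from Subtype.ext (hX.trans hX'.symm)]

theorem exists_lt_val_eq_inf {Y' : 𝒜.IntersectionPoset} (hD : IsIdealDecomposition ![I, J])
    (hY : Y ∈ I) (hZ : Z ∈ J) (hX : X.1 = Y.1 ⊓ Z.1) (hlt : Y' < Y) :
    ∃ X' < X, X'.1 = Y'.1 ⊓ Z.1 := by
  obtain ⟨X', hX', hrank⟩ := hD.exists_val_eq_inf (hD.isLowerSet_left hlt.le hY) hZ
  have hle : X' ≤ X := show X.1 ≤ X'.1 from hX ▸ hX' ▸ inf_le_inf_right _ hlt.le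
  refine ⟨X', hle.lt_of_ne fun h => (rank_strictMono hlt).ne ?_, hX'⟩
  rw [h, hD.rank_eq_add hY hZ hX] at hrank
  exact (Nat.add_right_cancel hrank).symm

theorem exists_inter_Iic_eq (hD : IsIdealDecomposition ![I, J]) (hX : X ≠ ⊥) :
    ∃ W : 𝒜.IntersectionPoset, W ≠ ⊥ ∧ (I ∩ Set.Iic X = Set.Iic W ∨ J ∩ Set.Iic X = Set.Iic W) := by
  obtain ⟨j, W, hW, h⟩ := hD.meet X hX
  refine ⟨W, hW, ?_⟩
  fin_cases j
  · exact Or.inl h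
  · exact Or.inr h

theorem eq_of_inter_Iic_eq (hD : IsIdealDecomposition ![I, J]) (hW : I ∩ Set.Iic X = Set.Iic W)
    (hY : Y ∈ I) (hZ : Z ∈ J) (hX : X.1 = Y.1 ⊓ Z.1) : Y = W := by
  have hYX : Y ≤ X := show X.1 ≤ Y.1 from hX ▸ inf_le_left
  have hYW : Y ≤ W := hW.le ⟨hY, hYX⟩
  obtain ⟨hWI, hWX⟩ : W ∈ I ∩ Set.Iic X := hW.ge (Set.mem_Iic.2 le_rfl)
  have hXWZ : X.1 = W.1 ⊓ Z.1 :=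
    le_antisymm (le_inf hWX (hX ▸ inf_le_right)) (hX ▸ inf_le_inf_right _ hYW)
  -- Replacing `Y` by `W` does not change the intersection with `Z`, so by (I3) the ranks agree.
  have hrank := (hD.rank_eq_add hY hZ hX).symm.trans (hD.rank_eq_add hWI hZ hXWZ)
  exact IntersectionPoset.eq_of_le_of_rank_le hYW (Nat.add_right_cancel hrank).ge

end IsIdealDecomposition

section Tensor

variable {F V K : Type*} [Field F] [AddCommGroup V] [Module F V] [CommRing K]
  {𝒜 : HyperplaneArrangement F V} {I J : Set 𝒜.IntersectionPoset}
  {W X Y Z : 𝒜.IntersectionPoset} {H : 𝒜.hyperplanes}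

variable (K I J) in
/-- The part `T_X` of `A(𝒜) ⊗ A(𝒜)` lying over a flat `X`: the sum of the images of `A_Y ⊗ A_Z`
for `Y ∈ I` and `Z ∈ J` with `Y ∩ Z = X`. -/
noncomputable def tensorComponent (X : 𝒜.IntersectionPoset) :
    Submodule K (𝒜.OSAlgebra K ⊗[K] 𝒜.OSAlgebra K) :=
  ⨆ (Y ∈ I) (Z ∈ J) (_ : X.1 = Y.1 ⊓ Z.1),
    Submodule.map₂ (TensorProduct.mk K _ _) (osComponent K Y) (osComponent K Z)

theorem tensorComponent_le_iff {p : Submodule K (𝒜.OSAlgebra K ⊗[K] 𝒜.OSAlgebra K)} :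
    tensorComponent K I J X ≤ p ↔ ∀ Y ∈ I, ∀ Z ∈ J, X.1 = Y.1 ⊓ Z.1 →
      ∀ a ∈ osComponent K Y, ∀ b ∈ osComponent K Z, a ⊗ₜ b ∈ p := by
  simp only [tensorComponent, iSup_le_iff, Submodule.map₂_le, TensorProduct.mk_apply]

theorem eqOn_tensorComponent {N : Type*} [AddCommGroup N] [Module K N]
    {f g : 𝒜.OSAlgebra K ⊗[K] 𝒜.OSAlgebra K →ₗ[K] N}
    (h : ∀ Y ∈ I, ∀ Z ∈ J, X.1 = Y.1 ⊓ Z.1 →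
      ∀ a ∈ osComponent K Y, ∀ b ∈ osComponent K Z, f (a ⊗ₜ b) = g (a ⊗ₜ b)) :
    ∀ t ∈ tensorComponent K I J X, f t = g t :=
  tensorComponent_le_iff (p := LinearMap.eqLocus f g).2 h

theorem tmul_mem_tensorComponent (hY : Y ∈ I) (hZ : Z ∈ J) (hX : X.1 = Y.1 ⊓ Z.1)
    {a b : 𝒜.OSAlgebra K} (ha : a ∈ osComponent K Y) (hb : b ∈ osComponent K Z) :
    a ⊗ₜ b ∈ tensorComponent K I J X :=
  tensorComponent_le_iff.1 le_rfl Y hY Z hZ hX a ha b hb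

theorem map_mul'_tensorComponent_le (X : 𝒜.IntersectionPoset) :
    (tensorComponent K I J X).map (LinearMap.mul' K (𝒜.OSAlgebra K)) ≤ osComponent K X :=
  Submodule.map_le_iff_le_comap.2 <| tensorComponent_le_iff.2 fun _ _ _ _ hX _ ha _ hb =>
    osComponent_mul_le hX (Submodule.mul_mem_mul ha hb)

/-- The operator `D_X = ∂_X ⊗ 1 + σ ⊗ ∂_X` on `A(𝒜) ⊗ A(𝒜)`, which corresponds to `∂_X` under
multiplication of components below `X`. -/
noncomputable def tensorBoundary (X : 𝒜.IntersectionPoset) :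
    𝒜.OSAlgebra K ⊗[K] 𝒜.OSAlgebra K →ₗ[K] 𝒜.OSAlgebra K ⊗[K] 𝒜.OSAlgebra K :=
  (osBoundary X).rTensor _ + TensorProduct.map osInvolute (osBoundary X)

theorem tensorBoundary_tmul (X : 𝒜.IntersectionPoset) (a b : 𝒜.OSAlgebra K) :
    tensorBoundary X (a ⊗ₜ[K] b) = osBoundary X a ⊗ₜ b + osInvolute a ⊗ₜ osBoundary X b :=
  rfl

theorem mul'_tensorBoundary {t : 𝒜.OSAlgebra K ⊗[K] 𝒜.OSAlgebra K}
    (ht : t ∈ tensorComponent K I J X) :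
    LinearMap.mul' K _ (tensorBoundary X t) = osBoundary X (LinearMap.mul' K _ t) := by
  refine eqOn_tensorComponent (f := LinearMap.mul' K _ ∘ₗ tensorBoundary X)
    (g := osBoundary X ∘ₗ LinearMap.mul' K _) (fun Y _ Z _ hX a ha b hb => ?_) t ht
  have hYX : Y ≤ X := show X.1 ≤ Y.1 from hX ▸ inf_le_left
  have hZX : Z ≤ X := show X.1 ≤ Z.1 from hX ▸ inf_le_right
  simp only [LinearMap.comp_apply, tensorBoundary_tmul, map_add,
    LinearMap.mul'_apply, osBoundary_mul, osLocalize_eq_self hYX ha, osLocalize_eq_self hZX hb]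

theorem tensorBoundary_mem (hD : IsIdealDecomposition ![I, J])
    {t : 𝒜.OSAlgebra K ⊗[K] 𝒜.OSAlgebra K} (ht : t ∈ tensorComponent K I J X) :
    tensorBoundary X t ∈ ⨆ X' : Set.Iio X, tensorComponent K I J X'.1 := by
  suffices h : tensorComponent K I J X ≤
    (⨆ X' : Set.Iio X, tensorComponent K I J X'.1).comap (tensorBoundary X) from h ht
  refine tensorComponent_le_iff.2 fun Y hY Z hZ hX a ha b hb => ?_
  have hYX : Y ≤ X := show X.1 ≤ Y.1 from hX ▸ inf_le_left
  have hZX : Z ≤ X := show X.1 ≤ Z.1 from hX ▸ inf_le_right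
  rw [Submodule.mem_comap, tensorBoundary_tmul]
  refine Submodule.add_mem _ (tmul_mem_of_mem_iSup_left (osBoundary_mem hYX ha) fun Y' a' ha' => ?_)
    (tmul_mem_of_mem_iSup_right (osBoundary_mem hZX hb) fun Z' b' hb' => ?_)
  · obtain ⟨X', hlt, hX'⟩ := hD.exists_lt_val_eq_inf hY hZ hX Y'.2.lt
    exact Submodule.mem_iSup_of_mem ⟨X', hlt⟩
      (tmul_mem_tensorComponent (hD.isLowerSet_left Y'.2.le hY) hZ hX' ha' hb)
  · obtain ⟨X', hlt, hX'⟩ := hD.swap.exists_lt_val_eq_inf hZ hY (hX.trans (inf_comm _ _)) Z'.2.lt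
    exact Submodule.mem_iSup_of_mem ⟨X', hlt⟩
      (tmul_mem_tensorComponent hY (hD.swap.isLowerSet_left Z'.2.le hZ)
        (hX'.trans (inf_comm _ _)) (osInvolute_mem ha) hb')

theorem map_mulLeft_tensorBoundary (hD : IsIdealDecomposition ![I, J])
    (hW : I ∩ Set.Iic X = Set.Iic W) (hH : W.1 ≤ H.1)
    {t : 𝒜.OSAlgebra K ⊗[K] 𝒜.OSAlgebra K} (ht : t ∈ tensorComponent K I J X) :
    (LinearMap.mulLeft K (osE K [H])).rTensor _ (tensorBoundary X t) = t := by
  refine eqOn_tensorComponent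
    (f := (LinearMap.mulLeft K (osE K [H])).rTensor _ ∘ₗ tensorBoundary X)
    (g := LinearMap.id) (fun Y hY Z hZ hX a ha b _ => ?_) t ht
  have hYX : Y ≤ X := show X.1 ≤ Y.1 from hX ▸ inf_le_left
  have hYH : Y.1 ≤ H.1 := hD.eq_of_inter_Iic_eq hW hY hZ hX ▸ hH
  change (osE K [H] * osBoundary X a) ⊗ₜ[K] b +
    (osE K [H] * osInvolute a) ⊗ₜ[K] osBoundary X b = a ⊗ₜ[K] b
  rw [osE_singleton_mul_osBoundary hYX hYH ha, osE_singleton_mul_eq_zero hYH (osInvolute_mem ha),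
    TensorProduct.zero_tmul, add_zero]

theorem map_osInvolute_mulLeft_tensorBoundary (hD : IsIdealDecomposition ![I, J])
    (hW : J ∩ Set.Iic X = Set.Iic W) (hH : W.1 ≤ H.1)
    {t : 𝒜.OSAlgebra K ⊗[K] 𝒜.OSAlgebra K} (ht : t ∈ tensorComponent K I J X) :
    TensorProduct.map osInvolute (LinearMap.mulLeft K (osE K [H])) (tensorBoundary X t) = t := by
  refine eqOn_tensorComponent
    (f := TensorProduct.map osInvolute (LinearMap.mulLeft K (osE K [H])) ∘ₗ tensorBoundary X)
    (g := LinearMap.id) (fun Y hY Z hZ hX a _ b hb => ?_) t ht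
  have hZX : Z ≤ X := show X.1 ≤ Z.1 from hX ▸ inf_le_right
  have hZH : Z.1 ≤ H.1 := hD.swap.eq_of_inter_Iic_eq hW hZ hY (hX.trans (inf_comm _ _)) ▸ hH
  change osInvolute (osBoundary X a) ⊗ₜ[K] (osE K [H] * b) +
    osInvolute (osInvolute a) ⊗ₜ[K] (osE K [H] * osBoundary X b) = a ⊗ₜ[K] b
  rw [osE_singleton_mul_osBoundary hZX hZH hb, osE_singleton_mul_eq_zero hZH hb,
    osInvolute_osInvolute, TensorProduct.tmul_zero, zero_add]

theorem eq_zero_of_tensorBoundary_eq_zero (hD : IsIdealDecomposition ![I, J]) (hX : X ≠ ⊥)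
    {t : 𝒜.OSAlgebra K ⊗[K] 𝒜.OSAlgebra K} (ht : t ∈ tensorComponent K I J X)
    (h : tensorBoundary X t = 0) : t = 0 := by
  obtain ⟨W, hWne, hW⟩ := hD.exists_inter_Iic_eq hX
  obtain ⟨H, hH⟩ := IntersectionPoset.exists_hyperplane_of_ne_bot hWne
  obtain hW | hW := hW
  · rw [← map_mulLeft_tensorBoundary hD hW hH ht, h, map_zero]
  · rw [← map_osInvolute_mulLeft_tensorBoundary hD hW hH ht, h, map_zero]

theorem exists_tmul_one_eq_of_mem_tensorComponent_bot {t : 𝒜.OSAlgebra K ⊗[K] 𝒜.OSAlgebra K}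
    (ht : t ∈ tensorComponent K I J ⊥) :
    ∃ a : 𝒜.OSAlgebra K, a ⊗ₜ[K] (1 : 𝒜.OSAlgebra K) = t := by
  let f := (TensorProduct.mk K (𝒜.OSAlgebra K) (𝒜.OSAlgebra K)).flip 1
  suffices h : tensorComponent K I J ⊥ ≤ LinearMap.range f from h ht
  refine tensorComponent_le_iff.2 fun Y _ Z _ hX a _ b hb => ?_
  obtain rfl : Z = ⊥ :=
    le_bot_iff.1 (show (⊤ : AffineSubspace F V) ≤ Z.1 from hX.le.trans inf_le_right)
  have hb' : b ∈ (1 : Submodule K (𝒜.OSAlgebra K)) := osComponent_bot (K := K) (𝒜 := 𝒜) ▸ hb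
  exact ⟨a * b, (tmul_eq_mul_tmul_one a hb').symm⟩

theorem disjoint_tensorComponent_ker_mul' (hD : IsIdealDecomposition ![I, J])
    (X : 𝒜.IntersectionPoset) :
    Disjoint (tensorComponent K I J X) (LinearMap.ker (LinearMap.mul' K (𝒜.OSAlgebra K))) := by
  induction X using WellFoundedLT.induction with
  | ind X ih =>
    refine LinearMap.disjoint_ker.2 fun t ht hmul => ?_
    obtain rfl | hX := eq_or_ne X ⊥
    · obtain ⟨a, rfl⟩ := exists_tmul_one_eq_of_mem_tensorComponent_bot ht
      rw [LinearMap.mul'_apply, mul_one] at hmul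
      rw [hmul, TensorProduct.zero_tmul]
    · refine eq_zero_of_tensorBoundary_eq_zero hD hX ht ?_
      have hind : iSupIndep fun X' : Set.Iio X =>
          (tensorComponent K I J X'.1).map (LinearMap.mul' K (𝒜.OSAlgebra K)) :=
        (iSupIndep_osComponent.comp Subtype.val_injective).mono
          fun X' => map_mul'_tensorComponent_le X'.1
      exact LinearMap.disjoint_ker.1
        (disjoint_iSup_ker_of_iSupIndep_map _ hind fun X' => ih X'.1 X'.2) _
        (tensorBoundary_mem hD ht) (by rw [mul'_tensorBoundary ht, hmul, map_zero])

end Tensor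

section Surjectivity

variable {F V K : Type*} [Field F] [AddCommGroup V] [Module F V] [CommRing K]
  {𝒜 : HyperplaneArrangement F V} {I J : Set 𝒜.IntersectionPoset}
  {W X X' Y Z : 𝒜.IntersectionPoset} {H : 𝒜.hyperplanes}

theorem exists_mem_val_eq_inf_hyperplane (hW : I ∩ Set.Iic X = Set.Iic W) (hH : W.1 ≤ H.1)
    (hY : Y ∈ I) (hYX : Y ≤ X) : ∃ Y' ∈ I, Y'.1 = H.1 ⊓ Y.1 := by
  have hle : W.1 ≤ H.1 ⊓ Y.1 := le_inf hH (hW.le ⟨hY, hYX⟩)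
  obtain ⟨Y', hY'⟩ := Y.exists_val_eq_hyperplane_inf (W.2.1.mono hle)
  exact ⟨Y', (hW.ge (show W.1 ≤ Y'.1 from hY' ▸ hle)).1, hY'⟩

theorem osE_singleton_mul_mem_map_of_left (hW : I ∩ Set.Iic X = Set.Iic W) (hH : W.1 ≤ H.1)
    (hX : X.1 = H.1 ⊓ X'.1) {a : 𝒜.OSAlgebra K}
    (ha : a ∈ (tensorComponent K I J X').map (LinearMap.mul' K (𝒜.OSAlgebra K))) :
    osE K [H] * a ∈ (tensorComponent K I J X).map (LinearMap.mul' K (𝒜.OSAlgebra K)) := by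
  obtain ⟨t, ht, rfl⟩ := ha
  suffices h : tensorComponent K I J X' ≤
    ((tensorComponent K I J X).map (LinearMap.mul' K (𝒜.OSAlgebra K))).comap
      (LinearMap.mulLeft K (osE K [H]) ∘ₗ LinearMap.mul' K (𝒜.OSAlgebra K)) from h ht
  refine tensorComponent_le_iff.2 fun Y hY Z hZ hX' a ha b hb => ?_
  have hYX : Y ≤ X := show X.1 ≤ Y.1 from hX ▸ inf_le_right.trans (hX' ▸ inf_le_left)
  obtain ⟨Y', hY'I, hY'⟩ := exists_mem_val_eq_inf_hyperplane hW hH hY hYX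
  have hmem : (osE K [H] * a) ⊗ₜ[K] b ∈ tensorComponent K I J X :=
    tmul_mem_tensorComponent hY'I hZ (by rw [hX, hX', hY', inf_assoc])
      (osE_singleton_mul_mem hY' ha) hb
  exact ⟨_, hmem, mul_assoc _ _ _⟩

theorem osE_singleton_mul_mem_map_of_right (hW : J ∩ Set.Iic X = Set.Iic W) (hH : W.1 ≤ H.1)
    (hX : X.1 = H.1 ⊓ X'.1) {a : 𝒜.OSAlgebra K}
    (ha : a ∈ (tensorComponent K I J X').map (LinearMap.mul' K (𝒜.OSAlgebra K))) :
    osE K [H] * a ∈ (tensorComponent K I J X).map (LinearMap.mul' K (𝒜.OSAlgebra K)) := by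
  obtain ⟨t, ht, rfl⟩ := ha
  suffices h : tensorComponent K I J X' ≤
    ((tensorComponent K I J X).map (LinearMap.mul' K (𝒜.OSAlgebra K))).comap
      (LinearMap.mulLeft K (osE K [H]) ∘ₗ LinearMap.mul' K (𝒜.OSAlgebra K)) from h ht
  refine tensorComponent_le_iff.2 fun Y hY Z hZ hX' a ha b hb => ?_
  have hZX : Z ≤ X := show X.1 ≤ Z.1 from hX ▸ inf_le_right.trans (hX' ▸ inf_le_right)
  obtain ⟨Z', hZ'J, hZ'⟩ := exists_mem_val_eq_inf_hyperplane hW hH hZ hZX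
  have hmem : osInvolute a ⊗ₜ[K] (osE K [H] * b) ∈ tensorComponent K I J X :=
    tmul_mem_tensorComponent hY hZ'J (by rw [hX, hX', hZ', inf_left_comm])
      (osInvolute_mem ha) (osE_singleton_mul_mem hZ' hb)
  refine ⟨_, hmem, ?_⟩
  change osInvolute a * (osE K [H] * b) = osE K [H] * (a * b)
  rw [← mul_assoc, ← osE_singleton_mul, mul_assoc]

theorem osComponent_le_map_mul'_tensorComponent (hD : IsIdealDecomposition ![I, J])
    (X : 𝒜.IntersectionPoset) :
    osComponent K X ≤ (tensorComponent K I J X).map (LinearMap.mul' K (𝒜.OSAlgebra K)) := by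
  induction X using WellFoundedLT.induction with
  | ind X ih =>
    obtain rfl | hX := eq_or_ne X ⊥
    · have hone : (1 : 𝒜.OSAlgebra K) ∈ osComponent K (⊥ : 𝒜.IntersectionPoset) :=
        Submodule.one_le.1 osComponent_bot.ge
      rw [osComponent_bot, Submodule.one_le]
      exact ⟨1 ⊗ₜ 1, tmul_mem_tensorComponent hD.bot_mem_left hD.swap.bot_mem_left
        (inf_idem _).symm hone hone, mul_one 1⟩
    obtain ⟨W, hWne, hW⟩ := hD.exists_inter_Iic_eq hX
    obtain ⟨H, hH⟩ := IntersectionPoset.exists_hyperplane_of_ne_bot hWne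
    have hWX : X.1 ≤ W.1 := by
      obtain hW | hW := hW <;> exact (hW.ge (Set.mem_Iic.2 le_rfl)).2
    intro a ha
    rw [← osE_singleton_mul_osBoundary le_rfl (hWX.trans hH) ha]
    suffices h : ⨆ X' : {X' // X' ⋖ X}, osComponent K X'.1 ≤
      ((tensorComponent K I J X).map (LinearMap.mul' K (𝒜.OSAlgebra K))).comap
        (LinearMap.mulLeft K (osE K [H])) from h (osBoundary_mem le_rfl ha)
    refine iSup_le fun X' b hb => ?_
    rw [Submodule.mem_comap, LinearMap.mulLeft_apply]
    by_cases hH' : X'.1.1 ≤ H.1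
    · rw [osE_singleton_mul_eq_zero hH' hb]
      exact zero_mem _
    have hinf : X.1 = H.1 ⊓ X'.1.1 :=
      IntersectionPoset.val_eq_hyperplane_inf_of_covBy X'.2 (hWX.trans hH) hH'
    have hb' := ih X'.1 X'.2.lt hb
    exact hW.elim (osE_singleton_mul_mem_map_of_left · hH hinf hb')
      (osE_singleton_mul_mem_map_of_right · hH hinf hb')

end Surjectivity

section Multiplication

variable {F V K : Type*} [Field F] [AddCommGroup V] [Module F V] [CommRing K]
  {𝒜 : HyperplaneArrangement F V} {I J : Set 𝒜.IntersectionPoset} {Y Z : 𝒜.IntersectionPoset}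

theorem kappa_eq_mul'_comp_map (I J : Set 𝒜.IntersectionPoset) :
    kappa K I J =
      LinearMap.mul' K (𝒜.OSAlgebra K) ∘ₗ TensorProduct.map (osSumMap K I) (osSumMap K J) :=
  TensorProduct.ext' fun _ _ => rfl

theorem osSumMap_eq_coeLinearMap [DecidableEq 𝒜.IntersectionPoset] (I : Set 𝒜.IntersectionPoset) :
    osSumMap K I = DirectSum.coeLinearMap fun X : I => osComponent K X.1 := by
  rw [osSumMap]
  congr!

theorem exists_leftInverse_osSumMap (I : Set 𝒜.IntersectionPoset) :
    ∃ g : 𝒜.OSAlgebra K →ₗ[K] OSSum K I, g ∘ₗ osSumMap K I = .id := by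
  classical
  rw [osSumMap_eq_coeLinearMap]
  exact exists_leftInverse_coeLinearMap isInternal_osComponent I

theorem osSumMap_apply (x : OSSum K I) :
    ∃ s : Finset I, osSumMap K I x = ∑ Y ∈ s, (x Y : 𝒜.OSAlgebra K) := by
  classical
  rw [osSumMap_eq_coeLinearMap, DirectSum.coeLinearMap_eq_dfinsuppSum]
  exact ⟨_, rfl⟩

theorem osSumMap_mem_iSup (x : OSSum K I) :
    osSumMap K I x ∈ ⨆ Y : I, osComponent K Y.1 := by
  obtain ⟨s, hs⟩ := osSumMap_apply x
  rw [hs]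
  exact Submodule.sum_mem _ fun Y _ => Submodule.mem_iSup_of_mem Y (x Y).2

theorem osSumMap_mem_osDegree {p : ℕ} {x : OSSum K I} (hx : x ∈ osSumDegree K I p) :
    osSumMap K I x ∈ osDegree 𝒜 K p := by
  obtain ⟨s, hs⟩ := osSumMap_apply x
  rw [hs]
  exact Submodule.sum_mem _ fun Y _ => Submodule.mem_iInf _ |>.1 hx Y

theorem osComponent_le_map_osSumDegree (hY : Y ∈ I) :
    osComponent K Y ≤ (osSumDegree K I (rank Y)).map (osSumMap K I) := by
  classical
  intro a ha
  refine ⟨DirectSum.lof K I (fun X : I => osComponent K X.1) ⟨Y, hY⟩ ⟨a, ha⟩,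
    (Submodule.mem_iInf _).2 fun X => ?_, ?_⟩
  · change ((DirectSum.lof K I (fun X : I => osComponent K X.1) ⟨Y, hY⟩ ⟨a, ha⟩) X :
      𝒜.OSAlgebra K) ∈ osDegree 𝒜 K (rank Y)
    obtain rfl | hne := eq_or_ne X ⟨Y, hY⟩
    · rw [DirectSum.lof_apply]
      exact osComponent_le_osDegree Y ha
    · rw [DirectSum.lof_eq_of, DirectSum.of_eq_of_ne _ _ _ hne]
      exact zero_mem _
  · rw [osSumMap_eq_coeLinearMap, DirectSum.coeLinearMap_lof]

theorem map_osSumMap_mem_iSup (hD : IsIdealDecomposition ![I, J])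
    (z : OSSum K I ⊗[K] OSSum K J) :
    TensorProduct.map (osSumMap K I) (osSumMap K J) z ∈ ⨆ X, tensorComponent K I J X := by
  induction z with
  | zero => rw [map_zero]; exact zero_mem _
  | add z w hz hw => rw [map_add]; exact add_mem hz hw
  | tmul x y =>
    refine tmul_mem_of_mem_iSup_left (osSumMap_mem_iSup x) fun Y a ha => ?_
    refine tmul_mem_of_mem_iSup_right (osSumMap_mem_iSup y) fun Z b hb => ?_
    obtain ⟨X, hX, -⟩ := hD.exists_val_eq_inf Y.2 Z.2
    exact Submodule.mem_iSup_of_mem X (tmul_mem_tensorComponent Y.2 Z.2 hX ha hb)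

theorem disjoint_iSup_tensorComponent_ker_mul' (hD : IsIdealDecomposition ![I, J]) :
    Disjoint (⨆ X, tensorComponent K I J X) (LinearMap.ker (LinearMap.mul' K (𝒜.OSAlgebra K))) :=
  disjoint_iSup_ker_of_iSupIndep_map _
    (iSupIndep_osComponent.mono map_mul'_tensorComponent_le)
    (disjoint_tensorComponent_ker_mul' hD)

theorem kappa_injective (hD : IsIdealDecomposition ![I, J]) :
    Function.Injective (kappa K I J) := by
  rw [kappa_eq_mul'_comp_map]
  intro z w hzw
  refine tensorMap_injective_of_leftInverse (exists_leftInverse_osSumMap I)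
    (exists_leftInverse_osSumMap J) ?_
  exact LinearMap.injOn_of_disjoint_ker le_rfl (disjoint_iSup_tensorComponent_ker_mul' hD)
    (map_osSumMap_mem_iSup hD z) (map_osSumMap_mem_iSup hD w) hzw

theorem osTensorDegree_le_iff {p : ℕ} {T : Submodule K (OSSum K I ⊗[K] OSSum K J)} :
    osTensorDegree K I J p ≤ T ↔ ∀ i j, i + j = p →
      ∀ x ∈ osSumDegree K I i, ∀ y ∈ osSumDegree K J j, x ⊗ₜ y ∈ T := by
  simp only [osTensorDegree, iSup_le_iff, TensorProduct.range_map, Submodule.range_subtype,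
    Submodule.map₂_le, TensorProduct.mk_apply]

theorem map_kappa_osTensorDegree_le (p : ℕ) :
    (osTensorDegree K I J p).map (kappa K I J) ≤ osDegree 𝒜 K p := by
  refine Submodule.map_le_iff_le_comap.2 (osTensorDegree_le_iff.2 ?_)
  rintro i j rfl x hx y hy
  exact osDegree_mul_le i j
    (Submodule.mul_mem_mul (osSumMap_mem_osDegree hx) (osSumMap_mem_osDegree hy))

theorem mul_mem_map_kappa (hY : Y ∈ I) (hZ : Z ∈ J) {a b : 𝒜.OSAlgebra K}
    (ha : a ∈ osComponent K Y) (hb : b ∈ osComponent K Z) :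
    a * b ∈ (osTensorDegree K I J (rank Y + rank Z)).map (kappa K I J) := by
  obtain ⟨x, hx, rfl⟩ := osComponent_le_map_osSumDegree hY ha
  obtain ⟨y, hy, rfl⟩ := osComponent_le_map_osSumDegree hZ hb
  have hxy : x ⊗ₜ[K] y ∈ osTensorDegree K I J (rank Y + rank Z) :=
    osTensorDegree_le_iff.1 (le_refl (osTensorDegree K I J _)) _ _ rfl x hx y hy
  exact Submodule.mem_map_of_mem hxy

theorem osComponent_le_map_kappa (hD : IsIdealDecomposition ![I, J]) (X : 𝒜.IntersectionPoset) :
    osComponent K X ≤ (osTensorDegree K I J (rank X)).map (kappa K I J) := by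
  refine (osComponent_le_map_mul'_tensorComponent hD X).trans ?_
  refine Submodule.map_le_iff_le_comap.2 (tensorComponent_le_iff.2 fun Y hY Z hZ hX a ha b hb => ?_)
  rw [hD.rank_eq_add hY hZ hX]
  exact mul_mem_map_kappa hY hZ ha hb

theorem map_kappa_osTensorDegree (hD : IsIdealDecomposition ![I, J]) (p : ℕ) :
    (osTensorDegree K I J p).map (kappa K I J) = osDegree 𝒜 K p := by
  refine le_antisymm (map_kappa_osTensorDegree_le p) ?_
  rw [osDegree_eq_iSup]
  refine iSup₂_le fun X hX => ?_
  rw [← hX]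
  exact osComponent_le_map_kappa hD X

theorem kappa_surjective (hD : IsIdealDecomposition ![I, J]) :
    Function.Surjective (kappa K I J) := by
  rw [← LinearMap.range_eq_top, ← top_le_iff, ← iSup_osDegree]
  refine iSup_le fun p => ?_
  rw [← map_kappa_osTensorDegree hD p]
  exact LinearMap.map_le_range

end Multiplication

end HyperplaneArrangement

theorem mainTheorem2_general {F V K : Type*} [Field F] [AddCommGroup V] [Module F V] [CommRing K]
    {𝒜 : HyperplaneArrangement F V} {I J : Set 𝒜.IntersectionPoset}
    (hD : HyperplaneArrangement.IsIdealDecomposition ![I, J]) :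
    DirectSum.IsInternal (HyperplaneArrangement.osTensorDegree K I J) ∧
    DirectSum.IsInternal (HyperplaneArrangement.osDegree 𝒜 K) ∧
    (∀ p : ℕ, (HyperplaneArrangement.osTensorDegree K I J p).map
        (HyperplaneArrangement.kappa K I J) = HyperplaneArrangement.osDegree 𝒜 K p) ∧
    Function.Bijective (HyperplaneArrangement.kappa K I J) := by
  have hbij : Function.Bijective (HyperplaneArrangement.kappa K I J) :=
    ⟨HyperplaneArrangement.kappa_injective hD, HyperplaneArrangement.kappa_surjective hD⟩
  have hmap := HyperplaneArrangement.map_kappa_osTensorDegree (K := K) hD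
  refine ⟨?_, HyperplaneArrangement.isInternal_osDegree, hmap, hbij⟩
  refine isInternal_of_isInternal_map hbij ?_
  exact (funext hmap : _ = HyperplaneArrangement.osDegree 𝒜 K) ▸
    HyperplaneArrangement.isInternal_osDegree

theorem mainTheorem2 {F V K : Type*} [Field F] [AddCommGroup V] [Module F V]
    [FiniteDimensional F V] [CommRing K] (𝒜 : HyperplaneArrangement F V)
    (I : Set 𝒜.IntersectionPoset) (hI : HyperplaneArrangement.IsModularIdeal I) :
    -- both sides are graded modules
    DirectSum.IsInternal (HyperplaneArrangement.osTensorDegree K I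
      (HyperplaneArrangement.meetComplement I)) ∧
    DirectSum.IsInternal (HyperplaneArrangement.osDegree 𝒜 K) ∧
    -- multiplication respects the gradings and is an isomorphism
    (∀ p : ℕ, (HyperplaneArrangement.osTensorDegree K I
        (HyperplaneArrangement.meetComplement I) p).map
        (HyperplaneArrangement.kappa K I (HyperplaneArrangement.meetComplement I)) =
      HyperplaneArrangement.osDegree 𝒜 K p) ∧
    Function.Bijective
      (HyperplaneArrangement.kappa K I (HyperplaneArrangement.meetComplement I)) :=
  mainTheorem2_general hI
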